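/- An infinite binary image is a coloring $I$ of $\mathbb{Z}^2$ with the two colors black and white; its white pixel density is $$\rho(I) := \liminf_{j\to\infty,\ j \text{ odd}} \frac{\#\{\text{white pixels of } I \text{ in the } j\times j \text{ box centered at the origin}\}}{j^2}.$$ Two pixels $x,y\in\mathbb{Z}^2$ are $4$-adjacent if $|x_1-y_1|+|x_2-y_2|=1$, and $8$-adjacent if $\max\{|x_1-y_1|,|x_2-y_2|\}=1$. For $\alpha\in\{4,8\}$, the white $\alpha$-connected components of $I$ are the connected components of the graph of $\alpha$-adjacency on the white pixels of $I$. For $k \in \mathbb{N}=\{1,2,3,\dots\}$, let $\Phi_\alpha(k)$ be the supremum of $\rho(I)$ over all infinite binary images $I$ whose white $\alpha$-connected components all have size at most $k$. For $n\in\mathbb{N}$ put $s_0(n) := (n-1)^2+n^2$, $s_1(n) := n(2n-1)$, $s_2(n) := 2n^2$, $s_3(n) := n(2n+1)$, and let $$\mathcal{S} := \mathbb{N}\cap\bigcup_{n=1}^\infty \Big(\Big[s_0(n)-\tfrac{n}{2},\, s_0(n)+\tfrac{n-1}{2}\Big] \cup \Big[s_2(n)-\tfrac{n}{2},\, s_2(n)+\tfrac{n}{2}\Big]\Big),$$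 $$\mathcal{U} := \mathbb{N}_{\ge 2}\cap\bigcup_{n=1}^\infty \Big(\Big[s_1(n),\, s_1(n)+\tfrac{n-1}{2}\Big] \cup \Big[s_3(n),\, s_3(n)+\tfrac{n}{2}\Big]\Big).$$ Then for all $k\in\mathbb{N}$, $$\Phi_8(k) = F_8(k) := \max_{1\le j\le k} \frac{j}{j+\lceil 2\sqrt{j}\,\rceil+1}, \qquad \Phi_4(k) \le F_4(k) := \max_{1\le j\le k} \frac{j}{j+\frac12\lceil 2\sqrt{2j-1}\,\rceil}.$$ Moreover $\Phi_4(k)=F_4(k)$ for all $k\in\mathcal{S}$, and $\Phi_4(k)<F_4(k)$ for all $k\in\mathcal{U}$. The set $\mathcal{S}$ has natural density $\frac12$, that is, $\lim_{N\to\infty} \#(\mathcal{S}\cap\{1,\dots,N\})/N = \frac12$. -/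

import Mathlib

noncomputable section

namespace WhiteDensity

/-- The two colours of a pixel. -/
inductive Color : Type
  | black
  | white

/-- An infinite binary image: a colouring of `ℤ²`. -/
abbrev Image : Type := ℤ × ℤ → Color

/-- The set of white pixels of an image. -/
def whitePixels (I : Image) : Set (ℤ × ℤ) := {p | I p = Color.white}

/-- The `j × j` box centred at the origin, with `j = 2 * m + 1` odd. -/
def box (m : ℕ) : Set (ℤ × ℤ) :=
  Set.Icc (-(m : ℤ)) (m : ℤ) ×ˢ Set.Icc (-(m : ℤ)) (m : ℤ)

/-- The white pixel density: the lower limit, over odd `j = 2 * m + 1`, of the proportion of white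
pixels in the `j × j` box centred at the origin. -/
def density (I : Image) : ℝ :=
  Filter.liminf
    (fun m : ℕ => ((whitePixels I ∩ box m).ncard : ℝ) / (2 * (m : ℝ) + 1) ^ 2) Filter.atTop

/-- The `ℓ¹` metric on `ℤ²`. -/
def d4 (x y : ℤ × ℤ) : ℤ := |x.1 - y.1| + |x.2 - y.2|

/-- The `ℓ^∞` metric on `ℤ²`. -/
def d8 (x y : ℤ × ℤ) : ℤ := max |x.1 - y.1| |x.2 - y.2|

/-- The graph of 4-adjacency on `ℤ²`. -/
def grid4 : SimpleGraph (ℤ × ℤ) where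
  Adj x y := d4 x y = 1
  symm := ⟨fun x y h => by
    simpa only [d4, abs_sub_comm y.1 x.1, abs_sub_comm y.2 x.2] using h⟩
  loopless := ⟨fun x h => by simp [d4] at h⟩

/-- The graph of 8-adjacency on `ℤ²`. -/
def grid8 : SimpleGraph (ℤ × ℤ) where
  Adj x y := d8 x y = 1
  symm := ⟨fun x y h => by
    simpa only [d8, abs_sub_comm y.1 x.1, abs_sub_comm y.2 x.2] using h⟩
  loopless := ⟨fun x h => by simp [d8] at h⟩

/-- Every white connected component of `I`, for the adjacency graph `G`, has at most `k` pixels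
(in particular, it is finite). -/
def WhiteComponentsLE (G : SimpleGraph (ℤ × ℤ)) (k : ℕ) (I : Image) : Prop :=
  ∀ C : (G.induce (whitePixels I)).ConnectedComponent, C.supp.encard ≤ (k : ℕ∞)

/-- The supremal white pixel density of an infinite image whose white connected components
have size at most `k`. -/
def Phi (G : SimpleGraph (ℤ × ℤ)) (k : ℕ) : ℝ :=
  sSup {r : ℝ | ∃ I : Image, WhiteComponentsLE G k I ∧ density I = r}

/-- `Φ₄(k)`. -/
def Phi4 (k : ℕ) : ℝ := Phi grid4 k

/-- `Φ₈(k)`. -/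
def Phi8 (k : ℕ) : ℝ := Phi grid8 k

/-- `F₄(k)`, the maximum over `1 ≤ j ≤ k` of `j / (j + ⌈2 √(2 j - 1)⌉ / 2)`. -/
def F4 (k : ℕ) (hk : 1 ≤ k) : ℝ :=
  (Finset.Icc 1 k).sup' (Finset.nonempty_Icc.2 hk)
    (fun j : ℕ => (j : ℝ) / ((j : ℝ) + (⌈2 * Real.sqrt (2 * (j : ℝ) - 1)⌉ : ℝ) / 2))

/-- `F₈(k)`, the maximum over `1 ≤ j ≤ k` of `j / (j + ⌈2 √j⌉ + 1)`. -/
def F8 (k : ℕ) (hk : 1 ≤ k) : ℝ :=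
  (Finset.Icc 1 k).sup' (Finset.nonempty_Icc.2 hk)
    (fun j : ℕ => (j : ℝ) / ((j : ℝ) + (⌈2 * Real.sqrt (j : ℝ)⌉ : ℝ) + 1))

/-- `s₀(n) = (n - 1)² + n²`. -/
def s0 (n : ℕ) : ℝ := ((n : ℝ) - 1) ^ 2 + (n : ℝ) ^ 2

/-- `s₁(n) = n (2 n - 1)`. -/
def s1 (n : ℕ) : ℝ := (n : ℝ) * (2 * (n : ℝ) - 1)

/-- `s₂(n) = 2 n²`. -/
def s2 (n : ℕ) : ℝ := 2 * (n : ℝ) ^ 2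

/-- `s₃(n) = n (2 n + 1)`. -/
def s3 (n : ℕ) : ℝ := (n : ℝ) * (2 * (n : ℝ) + 1)

/-- The set `𝒮`. -/
def setS : Set ℕ :=
  {k | 1 ≤ k ∧ ∃ n : ℕ, 1 ≤ n ∧
    ((k : ℝ) ∈ Set.Icc (s0 n - (n : ℝ) / 2) (s0 n + ((n : ℝ) - 1) / 2) ∨
      (k : ℝ) ∈ Set.Icc (s2 n - (n : ℝ) / 2) (s2 n + (n : ℝ) / 2))}

/-- The set `𝒰`. -/
def setU : Set ℕ :=
  {k | 2 ≤ k ∧ ∃ n : ℕ, 1 ≤ n ∧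
    ((k : ℝ) ∈ Set.Icc (s1 n) (s1 n + ((n : ℝ) - 1) / 2) ∨
      (k : ℝ) ∈ Set.Icc (s3 n) (s3 n + (n : ℝ) / 2))}

/-- The set `A` of positive integers has natural density `d`. -/
def HasNaturalDensity (A : Set ℕ) (d : ℝ) : Prop :=
  Filter.Tendsto (fun N : ℕ => ((A ∩ Set.Icc 1 N).ncard : ℝ) / (N : ℝ)) Filter.atTop (nhds d)

end WhiteDensity

end

noncomputable section

namespace WhiteDensity

open Finset Filter
open scoped Topology

/-!
Upper bounds: weigh the pairs of a component and a `2 × 2` cell, by `1` if they meet (8-adjacency)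
or by the number of diagonals of the cell that the component meets (4-adjacency). A cell carries
total weight at most `1`, respectively `2`, while a component of size `j` carries at least the
denominator of `F8`, respectively twice that of `F4`, by an isoperimetric inequality in the axis
directions, respectively in the diagonal directions. Averaging over large boxes bounds the
density.

Attainment: translates along a lattice of a partially filled rectangle (8-adjacency), or of a
diagonal box with a notch in one side together with its point reflection (4-adjacency), have the
optimal ratio of size to area.

Strictness: for sizes in `setU`, an optimal component is a full diagonal box with one even and one
odd side. Near such a box there is always a suboptimal component or a cell of deficient weight, so
a positive proportion of the plane is wasted.
-/

/-! ### Connected components of induced subgraphs -/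

section Components

variable {V : Type*} {G : SimpleGraph V} {W : Set V} {C D : Finset V} {x y : V}

/-- `C` is the vertex set of a connected component of the subgraph of `G` induced on `W`. It is
recorded as a finset of `V`, so that only finite components qualify. -/
def IsComponent (G : SimpleGraph V) (W : Set V) (C : Finset V) : Prop :=
  ∃ K : (G.induce W).ConnectedComponent, (C : Set V) = Subtype.val '' K.supp

namespace IsComponent

theorem exists_forall_mem_iff (hC : IsComponent G W C) :
    ∃ K : (G.induce W).ConnectedComponent,
      ∀ x, x ∈ C ↔ ∃ hx : x ∈ W, (G.induce W).connectedComponentMk ⟨x, hx⟩ = K := by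
  obtain ⟨K, hK⟩ := hC
  refine ⟨K, fun x => ?_⟩
  rw [← Finset.mem_coe, hK]
  simp

theorem mem_of_mem (hC : IsComponent G W C) (hx : x ∈ C) : x ∈ W := by
  obtain ⟨K, hK⟩ := hC.exists_forall_mem_iff
  exact ((hK x).1 hx).1

theorem nonempty (hC : IsComponent G W C) : C.Nonempty := by
  obtain ⟨K, hK⟩ := hC
  rw [← Finset.coe_nonempty, hK]
  exact K.nonempty_supp.image _

theorem eq_of_mem (hC : IsComponent G W C) (hD : IsComponent G W D) (hxC : x ∈ C) (hxD : x ∈ D) :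
    C = D := by
  obtain ⟨K, hK⟩ := hC.exists_forall_mem_iff
  obtain ⟨L, hL⟩ := hD.exists_forall_mem_iff
  obtain ⟨_, rfl⟩ := (hK x).1 hxC
  obtain ⟨_, rfl⟩ := (hL x).1 hxD
  ext z
  rw [hK, hL]

theorem mem_of_adj (hC : IsComponent G W C) (hx : x ∈ C) (hy : y ∈ W) (h : G.Adj x y) : y ∈ C := by
  obtain ⟨K, hK⟩ := hC.exists_forall_mem_iff
  obtain ⟨hxW, rfl⟩ := (hK x).1 hx
  have hyx : (G.induce W).Adj ⟨y, hy⟩ ⟨x, hxW⟩ := h.symm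
  exact (hK y).2 ⟨hy, SimpleGraph.ConnectedComponent.sound hyx.reachable⟩

theorem eq_of_adj (hC : IsComponent G W C) (hD : IsComponent G W D) (hx : x ∈ C) (hy : y ∈ D)
    (h : G.Adj x y) : C = D :=
  hC.eq_of_mem hD (hC.mem_of_adj hx (hD.mem_of_mem hy) h) hy

theorem reachable (hC : IsComponent G W C) (hx : x ∈ C) (hy : y ∈ C) :
    (G.induce W).Reachable ⟨x, hC.mem_of_mem hx⟩ ⟨y, hC.mem_of_mem hy⟩ := by
  obtain ⟨K, hK⟩ := hC.exists_forall_mem_iff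
  obtain ⟨_, hxK⟩ := (hK x).1 hx
  obtain ⟨_, hyK⟩ := (hK y).1 hy
  exact SimpleGraph.ConnectedComponent.exact (hxK.trans hyK.symm)

theorem exists_eq_of_le_of_le (hC : IsComponent G W C) {f : V → ℤ}
    (hf : ∀ x y, G.Adj x y → |f x - f y| ≤ 1) (hx : x ∈ C) (hy : y ∈ C) {c : ℤ}
    (hxc : f x ≤ c) (hcy : c ≤ f y) : ∃ z ∈ C, f z = c := by
  have along_walk : ∀ a b : W, (G.induce W).Walk a b → (a : V) ∈ C → f a ≤ c → c ≤ f b →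
      ∃ z ∈ C, f z = c := by
    intro a b walk
    induction walk with
    | nil => exact fun ha hac hca => ⟨_, ha, le_antisymm hac hca⟩
    | @cons a b d hab _ ih =>
      intro ha hac hcd
      have hadj : G.Adj a b := hab
      obtain hac' | hac' := hac.eq_or_lt
      · exact ⟨a, ha, hac'⟩
      · have hstep := abs_le.1 (hf a b hadj)
        exact ih (hC.mem_of_adj ha b.2 hadj) (by lia) hcd
  obtain ⟨walk⟩ := hC.reachable hx hy
  exact along_walk _ _ walk hx hxc hcy

theorem exists_image_eq_Icc (hC : IsComponent G W C) {f : V → ℤ}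
    (hf : ∀ x y, G.Adj x y → |f x - f y| ≤ 1) : ∃ a b, C.image f = Icc a b := by
  obtain ⟨x, hx, hmin⟩ := C.exists_min_image f hC.nonempty
  obtain ⟨y, hy, hmax⟩ := C.exists_max_image f hC.nonempty
  refine ⟨f x, f y, ?_⟩
  ext c
  rw [mem_image, mem_Icc]
  constructor
  · rintro ⟨z, hz, rfl⟩
    exact ⟨hmin z hz, hmax z hz⟩
  · exact fun hc => hC.exists_eq_of_le_of_le hf hx hy hc.1 hc.2

theorem sub_lt_card (hC : IsComponent G W C) {f : V → ℤ}
    (hf : ∀ x y, G.Adj x y → |f x - f y| ≤ 1) (hx : x ∈ C) (hy : y ∈ C) : f y - f x < #C := by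
  obtain ⟨a, b, hab⟩ := hC.exists_image_eq_Icc hf
  have hfx : f x ∈ Icc a b := hab ▸ mem_image_of_mem f hx
  have hfy : f y ∈ Icc a b := hab ▸ mem_image_of_mem f hy
  have hcard : #(Icc a b) ≤ #C := hab ▸ card_image_le
  rw [Int.card_Icc] at hcard
  rw [mem_Icc] at hfx hfy
  lia

open Classical in
theorem sum_ite_mem_le [DecidableEq V] {𝒞 : Finset (Finset V)}
    (h𝒞 : ∀ C ∈ 𝒞, IsComponent G W C) (x : V) :
    ∑ C ∈ 𝒞, (if x ∈ C then 1 else 0) ≤ if x ∈ W then 1 else 0 := by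
  rw [sum_boole]
  split_ifs with hx
  · refine card_le_one.2 fun C hC D hD => ?_
    rw [mem_filter] at hC hD
    exact (h𝒞 C hC.1).eq_of_mem (h𝒞 D hD.1) hC.2 hD.2
  · refine (card_eq_zero.2 (filter_eq_empty_iff.2 fun C hC hxC => hx ?_)).le
    exact (h𝒞 C hC).mem_of_mem hxC

end IsComponent

end Components

section WhiteComponents

variable {G : SimpleGraph (ℤ × ℤ)} {I : Image} {k : ℕ} {C : Finset (ℤ × ℤ)} {x : ℤ × ℤ}

theorem WhiteComponentsLE.exists_isComponent (hI : WhiteComponentsLE G k I)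
    (hx : x ∈ whitePixels I) : ∃ C, IsComponent G (whitePixels I) C ∧ x ∈ C := by
  let K := (G.induce (whitePixels I)).connectedComponentMk ⟨x, hx⟩
  have hfin := (Set.finite_of_encard_le_coe (hI K)).image Subtype.val
  refine ⟨hfin.toFinset, ⟨K, hfin.coe_toFinset⟩, ?_⟩
  rw [Set.Finite.mem_toFinset]
  exact ⟨⟨x, hx⟩, rfl, rfl⟩

theorem WhiteComponentsLE.card_le (hI : WhiteComponentsLE G k I)
    (hC : IsComponent G (whitePixels I) C) : #C ≤ k := by
  obtain ⟨K, hK⟩ := hC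
  have hcard := hI K
  rw [← Subtype.val_injective.encard_image, ← hK, Set.encard_coe_eq_coe_finsetCard] at hcard
  exact_mod_cast hcard

end WhiteComponents

theorem grid8_adj_iff {x y : ℤ × ℤ} : grid8.Adj x y ↔ max |x.1 - y.1| |x.2 - y.2| = 1 := Iff.rfl

theorem grid4_adj_iff {x y : ℤ × ℤ} : grid4.Adj x y ↔ |x.1 - y.1| + |x.2 - y.2| = 1 := Iff.rfl

theorem grid4_le_grid8 : grid4 ≤ grid8 := by
  intro x y h
  rw [grid4_adj_iff] at h
  rw [grid8_adj_iff]
  have hfst := abs_nonneg (x.1 - y.1)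
  have hsnd := abs_nonneg (x.2 - y.2)
  lia

/-! ### Counting pixels in boxes -/

/-- The centred box `box m` as a finset. -/
def boxFinset (m : ℕ) : Finset (ℤ × ℤ) :=
  Icc (-(m : ℤ)) m ×ˢ Icc (-(m : ℤ)) m

theorem mem_boxFinset {m : ℕ} {z : ℤ × ℤ} :
    z ∈ boxFinset m ↔ (-(m : ℤ) ≤ z.1 ∧ z.1 ≤ m) ∧ (-(m : ℤ) ≤ z.2 ∧ z.2 ≤ m) := by
  simp [boxFinset]

theorem card_boxFinset (m : ℕ) : #(boxFinset m) = (2 * m + 1) ^ 2 := by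
  rw [boxFinset, card_product, Int.card_Icc, sq]
  congr 1 <;> lia

theorem boxFinset_mono {l m : ℕ} (h : l ≤ m) : boxFinset l ⊆ boxFinset m := by
  intro z hz
  rw [mem_boxFinset] at hz ⊢
  lia

open Classical in
/-- The number of elements of `A` in the centred box `box m`. -/
def boxCount (A : Set (ℤ × ℤ)) (m : ℕ) : ℕ := #{z ∈ boxFinset m | z ∈ A}

theorem ncard_inter_box (A : Set (ℤ × ℤ)) (m : ℕ) : (A ∩ box m).ncard = boxCount A m := by
  classical
  rw [boxCount, ← Set.ncard_coe_finset]
  congr 1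
  ext z
  simp only [box, boxFinset, coe_filter, Set.mem_inter_iff, Set.mem_prod, Set.mem_Icc,
    mem_product, mem_Icc, Set.mem_ofPred_eq]
  tauto

theorem boxCount_union_le (A B : Set (ℤ × ℤ)) (m : ℕ) :
    boxCount (A ∪ B) m ≤ boxCount A m + boxCount B m := by
  classical
  rw [boxCount, boxCount, boxCount]
  simp only [Set.mem_union, filter_or]
  exact card_union_le _ _

theorem boxCount_le (A : Set (ℤ × ℤ)) (m : ℕ) : boxCount A m ≤ (2 * m + 1) ^ 2 := by
  classical
  exact (card_filter_le _ _).trans_eq (card_boxFinset m)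

theorem tendsto_box_ratio (c : ℝ) :
    Tendsto (fun m : ℕ => (2 * (m : ℝ) + c) ^ 2 / (2 * (m : ℝ) + 1) ^ 2) atTop (𝓝 1) := by
  have hden : Tendsto (fun m : ℕ => 2 * (m : ℝ) + 1) atTop atTop :=
    tendsto_atTop_add_const_right _ _
      (tendsto_natCast_atTop_atTop.const_mul_atTop two_pos)
  have hquot : Tendsto (fun m : ℕ => (c - 1) / (2 * (m : ℝ) + 1)) atTop (𝓝 0) :=
    tendsto_const_nhds.div_atTop hden
  have hsq := (hquot.const_add 1).pow 2
  rw [add_zero, one_pow] at hsq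
  refine hsq.congr fun m => ?_
  have : 2 * (m : ℝ) + 1 ≠ 0 := by positivity
  field_simp
  ring

section Density

variable {I : Image} {θ c : ℝ}

theorem density_le_of_tendsto {v : ℕ → ℝ}
    (hv : ∀ᶠ m : ℕ in atTop, (boxCount (whitePixels I) m : ℝ) / (2 * (m : ℝ) + 1) ^ 2 ≤ v m)
    (hθ : Tendsto v atTop (𝓝 θ)) : density I ≤ θ := by
  simp only [density, ncard_inter_box]
  rw [← hθ.liminf_eq]
  refine liminf_le_liminf hv ?_ ?_
  · exact isBoundedUnder_of ⟨0, fun m => by positivity⟩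
  · exact hθ.isBoundedUnder_le.isCoboundedUnder_ge

theorem density_le_of_boxCount_le
    (h : ∀ m : ℕ, (boxCount (whitePixels I) m : ℝ) ≤ θ * (2 * (m : ℝ) + c) ^ 2) :
    density I ≤ θ := by
  have hlim := (tendsto_box_ratio c).const_mul θ
  rw [mul_one] at hlim
  refine density_le_of_tendsto (Eventually.of_forall fun m => ?_) hlim
  rw [← mul_div_assoc]
  exact div_le_div_of_nonneg_right (h m) (by positivity)

theorem density_le_one : density I ≤ 1 := by
  refine density_le_of_boxCount_le (c := 1) fun m => ?_
  rw [one_mul]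
  exact_mod_cast boxCount_le _ m

theorem le_density_of_tendsto {v : ℕ → ℝ}
    (hv : ∀ᶠ m : ℕ in atTop, v m ≤ (boxCount (whitePixels I) m : ℝ) / (2 * (m : ℝ) + 1) ^ 2)
    (hθ : Tendsto v atTop (𝓝 θ)) : θ ≤ density I := by
  simp only [density, ncard_inter_box]
  rw [← hθ.liminf_eq]
  refine liminf_le_liminf hv hθ.isBoundedUnder_ge ?_
  refine (isBoundedUnder_of ⟨1, fun m => ?_⟩).isCoboundedUnder_ge
  rw [div_le_one (by positivity)]
  exact_mod_cast boxCount_le _ m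

/-- `A` meets every square of side `2 * R + 1`. -/
def IsDenseAtScale (A : Set (ℤ × ℤ)) (R : ℕ) : Prop :=
  ∀ z : ℤ × ℤ, ∃ y ∈ A, |y.1 - z.1| ≤ R ∧ |y.2 - z.2| ≤ R

theorem IsDenseAtScale.sq_le_boxCount_mul {A : Set (ℤ × ℤ)} {R : ℕ} (hA : IsDenseAtScale A R)
    (l : ℕ) : (2 * l + 1) ^ 2 ≤ boxCount A (R + l) * (2 * R + 1) ^ 2 := by
  classical
  have hcover : boxFinset l ⊆ {y ∈ boxFinset (R + l) | y ∈ A}.biUnion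
      fun y => (boxFinset R).image (y + ·) := by
    intro z hz
    obtain ⟨y, hyA, hfst, hsnd⟩ := hA z
    rw [abs_le] at hfst hsnd
    rw [mem_boxFinset] at hz
    refine mem_biUnion.2 ⟨y, mem_filter.2 ⟨?_, hyA⟩, mem_image.2 ⟨z - y, ?_, by simp⟩⟩
    · rw [mem_boxFinset]
      lia
    · rw [mem_boxFinset, Prod.fst_sub, Prod.snd_sub]
      lia
  rw [← card_boxFinset l]
  exact (card_le_card hcover).trans (card_biUnion_le_card_mul _ _ _
    fun y _ => card_image_le.trans (card_boxFinset R).le)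

theorem density_le_sub_of_isDenseAtScale {A : Set (ℤ × ℤ)} {δ : ℝ} {R : ℕ} (hδ : 0 ≤ δ)
    (hcount : ∀ m : ℕ, (boxCount (whitePixels I) m : ℝ) + δ * boxCount A m ≤
      θ * (2 * (m : ℝ) + c) ^ 2)
    (hA : IsDenseAtScale A R) : density I ≤ θ - δ / (2 * (R : ℝ) + 1) ^ 2 := by
  have hlim := ((tendsto_box_ratio c).const_mul θ).sub
    ((tendsto_box_ratio (1 - 2 * R)).const_mul (δ / (2 * (R : ℝ) + 1) ^ 2))
  rw [mul_one, mul_one] at hlim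
  refine density_le_of_tendsto ?_ hlim
  filter_upwards [eventually_ge_atTop R] with m hm
  rw [← mul_div_assoc, ← mul_div_assoc, ← sub_div]
  refine div_le_div_of_nonneg_right ?_ (by positivity)
  obtain ⟨l, rfl⟩ := Nat.exists_eq_add_of_le hm
  have hl : (2 * (l : ℝ) + 1) ^ 2 ≤ boxCount A (R + l) * (2 * (R : ℝ) + 1) ^ 2 := by
    exact_mod_cast hA.sq_le_boxCount_mul l
  have hdefect : δ / (2 * (R : ℝ) + 1) ^ 2 * (2 * (l : ℝ) + 1) ^ 2 ≤ δ * boxCount A (R + l) := by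
    rw [div_mul_eq_mul_div, div_le_iff₀ (by positivity), mul_assoc]
    exact mul_le_mul_of_nonneg_left hl hδ
  have hside : 2 * ((R + l : ℕ) : ℝ) + (1 - 2 * R) = 2 * l + 1 := by push_cast; ring
  rw [hside]
  linarith [hcount (R + l)]

end Density

section Phi

variable {G : SimpleGraph (ℤ × ℤ)} {k : ℕ}

theorem whiteComponentsLE_black : WhiteComponentsLE G k fun _ => Color.black := by
  intro K
  obtain ⟨⟨x, hx⟩, -⟩ := K.nonempty_supp
  simp [whitePixels] at hx

theorem Phi_le {θ : ℝ} (h : ∀ I, WhiteComponentsLE G k I → density I ≤ θ) : Phi G k ≤ θ := by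
  refine csSup_le ⟨_, _, whiteComponentsLE_black, rfl⟩ ?_
  rintro _ ⟨I, hI, rfl⟩
  exact h I hI

theorem density_le_Phi {I : Image} (hI : WhiteComponentsLE G k I) : density I ≤ Phi G k := by
  refine le_csSup ⟨1, ?_⟩ ⟨I, hI, rfl⟩
  rintro _ ⟨J, -, rfl⟩
  exact density_le_one

end Phi

/-! ### Weighted counting on the cells of the grid -/

/-- The `2 × 2` cell with least corner `z`. -/
def cell (z : ℤ × ℤ) : Finset (ℤ × ℤ) := {z, z + (1, 0), z + (0, 1), z + (1, 1)}

/-- The cells meeting `C`, each represented by its least corner. -/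
def cells (C : Finset (ℤ × ℤ)) : Finset (ℤ × ℤ) :=
  C.biUnion fun x => {x, x - (1, 0), x - (0, 1), x - (1, 1)}

theorem mem_cell {x z : ℤ × ℤ} :
    x ∈ cell z ↔ x = z ∨ x = z + (1, 0) ∨ x = z + (0, 1) ∨ x = z + (1, 1) := by
  simp [cell]

theorem mem_cells {C : Finset (ℤ × ℤ)} {z : ℤ × ℤ} : z ∈ cells C ↔ ∃ x ∈ C, x ∈ cell z := by
  simp [cells, mem_cell, eq_sub_iff_add_eq, eq_comm]

theorem eq_or_grid8_adj_of_mem_cell {x y z : ℤ × ℤ} (hx : x ∈ cell z) (hy : y ∈ cell z) :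
    x = y ∨ grid8.Adj x y := by
  rw [mem_cell] at hx hy
  rcases hx with rfl | rfl | rfl | rfl <;> rcases hy with rfl | rfl | rfl | rfl <;>
    simp [grid8_adj_iff]

section WeightedCounting

variable {G : SimpleGraph (ℤ × ℤ)} {I : Image} {k : ℕ}

theorem abs_fst_sub_le_of_grid8_adj {x y : ℤ × ℤ} (h : grid8.Adj x y) : |x.1 - y.1| ≤ 1 :=
  (le_max_left _ _).trans (grid8_adj_iff.1 h).le

theorem abs_snd_sub_le_of_grid8_adj {x y : ℤ × ℤ} (h : grid8.Adj x y) : |x.2 - y.2| ≤ 1 :=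
  (le_max_right _ _).trans (grid8_adj_iff.1 h).le

theorem WhiteComponentsLE.cells_subset_boxFinset (hI : WhiteComponentsLE G k I) (hG : G ≤ grid8)
    {C : Finset (ℤ × ℤ)} (hC : IsComponent G (whitePixels I) C) {m : ℕ} {x : ℤ × ℤ} (hxC : x ∈ C)
    (hx : x ∈ boxFinset m) : cells C ⊆ boxFinset (m + k + 1) := by
  have hfst : ∀ y z, G.Adj y z → |y.1 - z.1| ≤ 1 :=
    fun _ _ h => abs_fst_sub_le_of_grid8_adj (hG h)
  have hsnd : ∀ y z, G.Adj y z → |y.2 - z.2| ≤ 1 :=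
    fun _ _ h => abs_snd_sub_le_of_grid8_adj (hG h)
  intro z hz
  obtain ⟨y, hyC, hyz⟩ := mem_cells.1 hz
  have hcard := hI.card_le hC
  have hfst_left := hC.sub_lt_card hfst hxC hyC
  have hfst_right := hC.sub_lt_card hfst hyC hxC
  have hsnd_left := hC.sub_lt_card hsnd hxC hyC
  have hsnd_right := hC.sub_lt_card hsnd hyC hxC
  rw [mem_boxFinset] at hx ⊢
  rw [mem_cell] at hyz
  simp only [Prod.ext_iff, Prod.fst_add, Prod.snd_add] at hyz
  lia

theorem WhiteComponentsLE.exists_finset_isComponent (hI : WhiteComponentsLE G k I)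
    (hG : G ≤ grid8) (m : ℕ) :
    ∃ 𝒞 : Finset (Finset (ℤ × ℤ)), (∀ C ∈ 𝒞, IsComponent G (whitePixels I) C) ∧
      (∀ C ∈ 𝒞, cells C ⊆ boxFinset (m + k + 1)) ∧
      ∀ x ∈ boxFinset m, x ∈ whitePixels I → ∃ C ∈ 𝒞, x ∈ C := by
  classical
  choose! comp hcomp hmem using fun x (hx : x ∈ whitePixels I) => hI.exists_isComponent hx
  refine ⟨{x ∈ boxFinset m | x ∈ whitePixels I}.image comp, ?_, ?_, fun x hx hxI =>
    ⟨comp x, mem_image_of_mem _ (mem_filter.2 ⟨hx, hxI⟩), hmem x hxI⟩⟩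
  all_goals
    simp only [forall_mem_image, mem_filter]
    rintro x ⟨hx, hxI⟩
  · exact hcomp x hxI
  · exact hI.cells_subset_boxFinset hG (hcomp x hxI) (hmem x hxI) hx

open Classical in
/- Double counting of the weights `ω C z` of the pairs of a component and a cell: `hcomp` bounds the
mass `f` of a component by its total weight, and `hcell` bounds the total weight on a cell, with a
slack `g`. -/
theorem WhiteComponentsLE.sum_add_sum_le (hI : WhiteComponentsLE G k I) (hG : G ≤ grid8)
    (ω : Finset (ℤ × ℤ) → ℤ × ℤ → ℕ) {f g : ℤ × ℤ → ℝ} {μ β : ℝ} (hf : ∀ x, 0 ≤ f x)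
    (hg : ∀ z, 0 ≤ g z) (hμ : 0 ≤ μ)
    (hcomp : ∀ C, IsComponent G (whitePixels I) C →
      ∑ x ∈ C, f x ≤ μ * ∑ z ∈ cells C, (ω C z : ℝ))
    (hcell : ∀ 𝒞 : Finset (Finset (ℤ × ℤ)), (∀ C ∈ 𝒞, IsComponent G (whitePixels I) C) →
      ∀ z, ∑ C ∈ 𝒞, (ω C z : ℝ) + g z ≤ β) (m : ℕ) :
    ∑ x ∈ boxFinset m with x ∈ whitePixels I, f x + μ * ∑ z ∈ boxFinset m, g z ≤
      μ * β * (2 * (m : ℝ) + (2 * k + 3)) ^ 2 := by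
  obtain ⟨𝒞, h𝒞, hcells, hcover⟩ := hI.exists_finset_isComponent hG m
  let B := boxFinset (m + k + 1)
  have hwhite : ∑ x ∈ boxFinset m with x ∈ whitePixels I, f x ≤ ∑ C ∈ 𝒞, ∑ x ∈ C, f x := by
    have hdisj : (𝒞 : Set (Finset (ℤ × ℤ))).PairwiseDisjoint id := fun C hC D hD hne =>
      disjoint_left.2 fun x hxC hxD => hne ((h𝒞 C hC).eq_of_mem (h𝒞 D hD) hxC hxD)
    refine le_of_le_of_eq ?_ (sum_biUnion hdisj)
    refine sum_le_sum_of_subset_of_nonneg (fun x hx => ?_) fun x _ _ => hf x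
    obtain ⟨C, hC, hxC⟩ := hcover x (mem_filter.1 hx).1 (mem_filter.1 hx).2
    exact mem_biUnion.2 ⟨C, hC, hxC⟩
  have hmass : ∑ C ∈ 𝒞, ∑ x ∈ C, f x ≤ μ * ∑ z ∈ B, ∑ C ∈ 𝒞, (ω C z : ℝ) := by
    rw [sum_comm, mul_sum]
    refine sum_le_sum fun C hC => (hcomp C (h𝒞 C hC)).trans (mul_le_mul_of_nonneg_left ?_ hμ)
    exact sum_le_sum_of_subset_of_nonneg (hcells C hC) fun z _ _ => Nat.cast_nonneg _
  have hslack : ∑ z ∈ boxFinset m, g z ≤ ∑ z ∈ B, g z :=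
    sum_le_sum_of_subset_of_nonneg (boxFinset_mono (by lia)) fun z _ _ => hg z
  calc ∑ x ∈ boxFinset m with x ∈ whitePixels I, f x + μ * ∑ z ∈ boxFinset m, g z
      ≤ μ * ∑ z ∈ B, ∑ C ∈ 𝒞, (ω C z : ℝ) + μ * ∑ z ∈ B, g z :=
        add_le_add (hwhite.trans hmass) (mul_le_mul_of_nonneg_left hslack hμ)
    _ = μ * ∑ z ∈ B, (∑ C ∈ 𝒞, (ω C z : ℝ) + g z) := by rw [sum_add_distrib, mul_add]
    _ ≤ μ * ∑ _z ∈ B, β :=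
        mul_le_mul_of_nonneg_left (sum_le_sum fun z _ => hcell 𝒞 h𝒞 z) hμ
    _ = μ * β * (2 * (m : ℝ) + (2 * k + 3)) ^ 2 := by
        rw [sum_const, card_boxFinset, nsmul_eq_mul]
        push_cast
        ring

theorem WhiteComponentsLE.density_le (hI : WhiteComponentsLE G k I) (hG : G ≤ grid8)
    (ω : Finset (ℤ × ℤ) → ℤ × ℤ → ℕ) {μ β : ℝ} (hμ : 0 ≤ μ)
    (hcomp : ∀ C, IsComponent G (whitePixels I) C → (#C : ℝ) ≤ μ * ∑ z ∈ cells C, (ω C z : ℝ))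
    (hcell : ∀ 𝒞 : Finset (Finset (ℤ × ℤ)), (∀ C ∈ 𝒞, IsComponent G (whitePixels I) C) →
      ∀ z, ∑ C ∈ 𝒞, (ω C z : ℝ) ≤ β) :
    density I ≤ μ * β := by
  refine density_le_of_boxCount_le (c := 2 * k + 3) fun m => ?_
  simpa [boxCount] using hI.sum_add_sum_le hG ω (f := fun _ => 1) (g := fun _ => 0)
    (by simp) (by simp) hμ (by simpa using hcomp) (by simpa using hcell) m

open Classical in
theorem WhiteComponentsLE.density_le_sub (hI : WhiteComponentsLE G k I) (hG : G ≤ grid8)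
    (ω : Finset (ℤ × ℤ) → ℤ × ℤ → ℕ) {D E : Set (ℤ × ℤ)} {δ μ β : ℝ} (hδ : 0 ≤ δ) (hδμ : δ ≤ μ)
    (hD : D ⊆ whitePixels I)
    (hcomp : ∀ C, IsComponent G (whitePixels I) C →
      (#C : ℝ) + δ * #{x ∈ C | x ∈ D} ≤ μ * ∑ z ∈ cells C, (ω C z : ℝ))
    (hcell : ∀ 𝒞 : Finset (Finset (ℤ × ℤ)), (∀ C ∈ 𝒞, IsComponent G (whitePixels I) C) →
      ∀ z, ∑ C ∈ 𝒞, (ω C z : ℝ) + (if z ∈ E then 1 else 0) ≤ β)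
    {R : ℕ} (hDE : IsDenseAtScale (D ∪ E) R) :
    density I ≤ μ * β - δ / (2 * (R : ℝ) + 1) ^ 2 := by
  refine density_le_sub_of_isDenseAtScale (c := 2 * k + 3) hδ (fun m => ?_) hDE
  have hcount := hI.sum_add_sum_le hG ω (f := fun x => 1 + δ * if x ∈ D then 1 else 0)
    (g := fun z => if z ∈ E then 1 else 0) (fun x => by positivity) (fun z => by positivity)
    (hδ.trans hδμ) (fun C hC => by
      rw [sum_add_distrib, ← mul_sum, sum_boole]
      simpa using hcomp C hC) hcell m
  have hDwhite : {x ∈ boxFinset m | x ∈ whitePixels I ∧ x ∈ D} = {x ∈ boxFinset m | x ∈ D} :=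
    filter_congr fun x _ => and_iff_right_of_imp (@hD x)
  rw [sum_add_distrib, ← mul_sum, sum_boole, sum_boole, sum_const, nsmul_one, filter_filter,
    hDwhite, ← boxCount, ← boxCount, ← boxCount] at hcount
  have hunion : (boxCount (D ∪ E) m : ℝ) ≤ boxCount D m + boxCount E m := by
    exact_mod_cast boxCount_union_le D E m
  have hslack : δ * boxCount E m ≤ μ * boxCount E m :=
    mul_le_mul_of_nonneg_right hδμ (Nat.cast_nonneg _)
  linarith [mul_le_mul_of_nonneg_left hunion hδ]

end WeightedCounting

/-! ### Isoperimetric inequalities -/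

section Compression

variable {α β γ : Type*} [DecidableEq α] [DecidableEq β] [LinearOrder γ] {s : α → α}

/- Every fibre of `f` in `C` gains at least one point: the image of its `g`-least element. -/
theorem card_add_card_image_le_card_union_image (C : Finset α) {f : α → β} {g : α → γ}
    (hf : ∀ x, f (s x) = f x) (hg : ∀ x, g (s x) < g x) :
    #C + #(C.image f) ≤ #(C ∪ C.image s) := by
  rw [← union_sdiff_self_eq_union, card_union_of_disjoint disjoint_sdiff]
  refine Nat.add_le_add_left ((card_le_card fun c hc => ?_).trans (card_image_le (f := f))) _
  obtain ⟨x, hx, rfl⟩ := mem_image.1 hc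
  obtain ⟨y, hy, hmin⟩ := exists_min_image {y ∈ C | f y = f x} g ⟨x, mem_filter.2 ⟨hx, rfl⟩⟩
  obtain ⟨hyC, hyf⟩ := mem_filter.1 hy
  refine mem_image.2 ⟨s y, mem_sdiff.2 ⟨mem_image_of_mem s hyC, fun hsy => ?_⟩, (hf y).trans hyf⟩
  exact (hmin (s y) (mem_filter.2 ⟨hsy, (hf y).trans hyf⟩)).not_gt (hg y)

theorem card_image_lt_card_image_union_image {C : Finset α} (hC : C.Nonempty) {g : α → γ}
    (hg : ∀ x, g (s x) < g x) : #(C.image g) < #((C ∪ C.image s).image g) := by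
  obtain ⟨x, hx, hmin⟩ := exists_min_image C g hC
  refine card_lt_card (ssubset_iff.2 ⟨g (s x), fun hsx => ?_, insert_subset ?_ ?_⟩)
  · obtain ⟨y, hy, hyx⟩ := mem_image.1 hsx
    exact ((hmin y hy).trans_eq hyx).not_gt (hg x)
  · exact mem_image_of_mem g (mem_union_right _ (mem_image_of_mem s hx))
  · exact image_subset_image subset_union_left

end Compression

theorem two_mul_sqrt_le_add {p q x : ℝ} (hp : 0 ≤ p) (hq : 0 ≤ q) (h : x ≤ p * q) :
    2 * √x ≤ p + q := by
  have hsqrt : √x ≤ (p + q) / 2 :=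
    Real.sqrt_le_iff.2 ⟨by positivity, by nlinarith [sq_nonneg (p - q)]⟩
  linarith

theorem card_add_card_image_lt_card_cells {C : Finset (ℤ × ℤ)} (hC : C.Nonempty) :
    #C + #(C.image Prod.fst) + #(C.image Prod.snd) < #(cells C) := by
  let C' := C ∪ C.image (· - (1, 0))
  have hright : #C + #(C.image Prod.snd) ≤ #C' :=
    card_add_card_image_le_card_union_image C (g := Prod.fst) (by simp) (by simp)
  have hup : #C' + #(C'.image Prod.fst) ≤ #(C' ∪ C'.image (· - (0, 1))) :=
    card_add_card_image_le_card_union_image C' (g := Prod.snd) (by simp) (by simp)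
  have hfst : #(C.image Prod.fst) < #(C'.image Prod.fst) :=
    card_image_lt_card_image_union_image hC (by simp)
  have hcells : #(C' ∪ C'.image (· - (0, 1))) ≤ #(cells C) := by
    refine card_le_card fun z hz => ?_
    simp only [C', mem_union, mem_image] at hz
    rw [cells, mem_biUnion]
    simp only [mem_insert, mem_singleton]
    rcases hz with (hz | ⟨x, hx, rfl⟩) | ⟨y, hy | ⟨x, hx, rfl⟩, rfl⟩
    · exact ⟨z, hz, Or.inl rfl⟩
    · exact ⟨x, hx, by simp⟩
    · exact ⟨y, hy, by simp⟩
    · exact ⟨x, hx, by simp [sub_sub]⟩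
  lia

theorem ceil_add_card_le_card_cells {C : Finset (ℤ × ℤ)} (hC : C.Nonempty) :
    #C + ⌈2 * √(#C : ℝ)⌉ + 1 ≤ #(cells C) := by
  have hceil : ⌈2 * √(#C : ℝ)⌉ ≤ #(C.image Prod.fst) + #(C.image Prod.snd) := by
    rw [Int.ceil_le]
    push_cast
    refine two_mul_sqrt_le_add (by positivity) (by positivity) ?_
    exact_mod_cast (card_le_card subset_product).trans_eq (card_product _ _)
  have hcells := card_add_card_image_lt_card_cells hC
  lia

/-- The number of diagonals of the cell at `z` that meet `C`. -/
def diagonalWeight (C : Finset (ℤ × ℤ)) (z : ℤ × ℤ) : ℕ :=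
  (if z ∈ C ∨ z + (1, 1) ∈ C then 1 else 0) + (if z + (1, 0) ∈ C ∨ z + (0, 1) ∈ C then 1 else 0)

theorem card_add_card_image_le_sum_diagonalWeight (C : Finset (ℤ × ℤ)) :
    2 * #C + #(C.image fun x => x.1 + x.2) + #(C.image fun x => x.1 - x.2) ≤
      ∑ z ∈ cells C, diagonalWeight C z := by
  have hmain : #C + #(C.image fun x => x.1 - x.2) ≤
      #{z ∈ cells C | z ∈ C ∨ z + (1, 1) ∈ C} := by
    refine (card_add_card_image_le_card_union_image C (s := (· - (1, 1))) (g := Prod.fst)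
      (by simp) (by simp)).trans (card_le_card fun z hz => ?_)
    rw [mem_union, mem_image] at hz
    rw [mem_filter, mem_cells]
    rcases hz with hz | ⟨x, hx, rfl⟩
    · exact ⟨⟨z, hz, by simp [mem_cell]⟩, Or.inl hz⟩
    · exact ⟨⟨x, hx, by simp [mem_cell]⟩, Or.inr (by simpa using hx)⟩
  have hanti : #C + #(C.image fun x => x.1 + x.2) ≤
      #{z ∈ cells C | z + (1, 0) ∈ C ∨ z + (0, 1) ∈ C} := by
    refine (card_add_card_image_le_card_union_image C (s := (· + (-1, 1))) (g := Prod.fst)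
      (by simp [add_add_add_comm]) (by simp)).trans ?_
    rw [← card_image_of_injective _ (sub_left_injective (b := ((0, 1) : ℤ × ℤ)))]
    refine card_le_card fun z hz => ?_
    rw [mem_image] at hz
    obtain ⟨y, hy, rfl⟩ := hz
    rw [mem_union, mem_image] at hy
    rw [mem_filter, mem_cells]
    rcases hy with hy | ⟨x, hx, rfl⟩
    · exact ⟨⟨y, hy, by simp [mem_cell]⟩, Or.inr (by simpa using hy)⟩
    · have hcorner : x + (-1, 1) - (0, 1) + (1, 0) = x := by ext <;> simp
      exact ⟨⟨x, hx, by simp [mem_cell, hcorner]⟩, Or.inl (hcorner.symm ▸ hx)⟩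
  simp only [diagonalWeight]
  rw [sum_add_distrib, sum_boole, sum_boole, Nat.cast_id, Nat.cast_id]
  lia

/-! ### Rotated boxes -/

/-- The pixels `z` with `a ≤ z.1 + z.2 ≤ b` and `c ≤ z.1 - z.2 ≤ d`. -/
def rotBox (a b c d : ℤ) : Finset (ℤ × ℤ) :=
  {p ∈ Icc a b ×ˢ Icc c d | Even (p.1 + p.2)}.image fun p => ((p.1 + p.2) / 2, (p.1 - p.2) / 2)

section RotBox

variable {a b c d : ℤ}

theorem mem_rotBox {z : ℤ × ℤ} :
    z ∈ rotBox a b c d ↔ (a ≤ z.1 + z.2 ∧ z.1 + z.2 ≤ b) ∧ (c ≤ z.1 - z.2 ∧ z.1 - z.2 ≤ d) := by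
  simp only [rotBox, mem_image, mem_filter, mem_product, mem_Icc]
  constructor
  · rintro ⟨⟨u, v⟩, ⟨h, r, hr⟩, rfl⟩
    lia
  · intro h
    exact ⟨(z.1 + z.2, z.1 - z.2), ⟨h, z.1, by lia⟩, Prod.ext (by lia) (by lia)⟩

theorem card_rotBox : #(rotBox a b c d) = #{p ∈ Icc a b ×ˢ Icc c d | Even (p.1 + p.2)} := by
  refine card_image_of_injOn ?_
  rintro ⟨u, v⟩ h ⟨u', v'⟩ h' heq
  obtain ⟨-, r, hr⟩ := mem_filter.1 h
  obtain ⟨-, r', hr'⟩ := mem_filter.1 h'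
  rw [Prod.mk.injEq] at heq ⊢
  lia

theorem sum_negOnePow_Ico (a : ℤ) (n : ℕ) :
    ∑ u ∈ Ico a (a + n), (u.negOnePow : ℤ) = if Even n then 0 else (a.negOnePow : ℤ) := by
  induction n with
  | zero => simp
  | succ n ih =>
    have hinsert : Ico a (a + (n + 1 : ℕ)) = insert (a + n) (Ico a (a + n)) := by
      ext u
      simp only [mem_Ico, mem_insert]
      lia
    rw [hinsert, sum_insert (by simp), ih]
    by_cases hn : Even n
    · simp [hn, Nat.even_add_one, Int.negOnePow_add, Int.negOnePow_even (n : ℤ) (by simpa using hn)]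
    · have hodd : Odd (n : ℤ) := by simpa using hn
      simp [hn, Nat.even_add_one, Int.negOnePow_add, Int.negOnePow_odd _ hodd]

theorem sum_negOnePow_Icc (a b : ℤ) :
    ∑ u ∈ Icc a b, (u.negOnePow : ℤ) = if Even #(Icc a b) then 0 else (a.negOnePow : ℤ) := by
  have hIco : Icc a b = Ico a (a + #(Icc a b)) := by
    ext u
    rw [Int.card_Icc, mem_Icc, mem_Ico]
    lia
  conv_lhs => rw [hIco]
  exact sum_negOnePow_Ico _ _

theorem two_mul_card_rotBox :
    2 * (#(rotBox a b c d) : ℤ) = #(Icc a b) * #(Icc c d) +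
      (∑ u ∈ Icc a b, (u.negOnePow : ℤ)) * ∑ v ∈ Icc c d, (v.negOnePow : ℤ) := by
  have hparity : ∀ p : ℤ × ℤ, 2 * (if Even (p.1 + p.2) then 1 else 0 : ℤ) =
      1 + (p.1.negOnePow : ℤ) * (p.2.negOnePow : ℤ) := by
    intro p
    rw [← Units.val_mul, ← Int.negOnePow_add]
    split_ifs with h
    · rw [Int.negOnePow_even _ h]; rfl
    · rw [Int.negOnePow_odd _ (Int.not_even_iff_odd.1 h)]; rfl
  rw [card_rotBox, ← sum_boole, mul_sum, sum_congr rfl fun p _ => hparity p, sum_add_distrib,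
    sum_mul_sum, ← sum_product', sum_const, card_product, nsmul_one, Nat.cast_mul]

theorem two_mul_card_rotBox_le : 2 * #(rotBox a b c d) ≤ #(Icc a b) * #(Icc c d) + 1 := by
  have hsign : ∀ a b : ℤ, |∑ u ∈ Icc a b, (u.negOnePow : ℤ)| ≤ 1 := by
    intro a b
    rw [sum_negOnePow_Icc]
    split_ifs
    · simp
    · rw [Int.abs_negOnePow]
  have hprod : (∑ u ∈ Icc a b, (u.negOnePow : ℤ)) * ∑ v ∈ Icc c d, (v.negOnePow : ℤ) ≤ 1 := by
    refine (le_abs_self _).trans ?_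
    rw [abs_mul]
    exact mul_le_one₀ (hsign a b) (abs_nonneg _) (hsign c d)
  have hcard := two_mul_card_rotBox (a := a) (b := b) (c := c) (d := d)
  zify
  linarith

theorem two_mul_card_rotBox_of_even (h : Even #(Icc a b) ∨ Even #(Icc c d)) :
    2 * #(rotBox a b c d) = #(Icc a b) * #(Icc c d) := by
  have hcard := two_mul_card_rotBox (a := a) (b := b) (c := c) (d := d)
  rw [sum_negOnePow_Icc, sum_negOnePow_Icc] at hcard
  zify
  rcases h with h | h <;> rw [hcard, if_pos h] <;> simp

theorem IsComponent.exists_subset_rotBox {W : Set (ℤ × ℤ)} {C : Finset (ℤ × ℤ)}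
    (hC : IsComponent grid4 W C) :
    ∃ a b c d, (C.image fun z => z.1 + z.2) = Icc a b ∧ (C.image fun z => z.1 - z.2) = Icc c d ∧
      C ⊆ rotBox a b c d := by
  have hadd : ∀ x y, grid4.Adj x y → |(x.1 + x.2) - (y.1 + y.2)| ≤ 1 := by
    intro x y h
    rw [add_sub_add_comm]
    exact (abs_add_le _ _).trans (grid4_adj_iff.1 h).le
  have hsub : ∀ x y, grid4.Adj x y → |(x.1 - x.2) - (y.1 - y.2)| ≤ 1 := by
    intro x y h
    rw [sub_sub_sub_comm]
    exact (abs_sub _ _).trans (grid4_adj_iff.1 h).le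
  obtain ⟨a, b, hab⟩ := hC.exists_image_eq_Icc hadd
  obtain ⟨c, d, hcd⟩ := hC.exists_image_eq_Icc hsub
  refine ⟨a, b, c, d, hab, hcd, fun z hz => ?_⟩
  have hzab := mem_image_of_mem (fun z : ℤ × ℤ => z.1 + z.2) hz
  have hzcd := mem_image_of_mem (fun z : ℤ × ℤ => z.1 - z.2) hz
  rw [hab, mem_Icc] at hzab
  rw [hcd, mem_Icc] at hzcd
  exact mem_rotBox.2 ⟨hzab, hzcd⟩

theorem IsComponent.ceil_add_card_le_sum_diagonalWeight {W : Set (ℤ × ℤ)} {C : Finset (ℤ × ℤ)}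
    (hC : IsComponent grid4 W C) :
    2 * #C + ⌈2 * √(2 * (#C : ℝ) - 1)⌉ ≤ ((∑ z ∈ cells C, diagonalWeight C z : ℕ) : ℤ) := by
  obtain ⟨a, b, c, d, hab, hcd, hbox⟩ := hC.exists_subset_rotBox
  have hweight := card_add_card_image_le_sum_diagonalWeight C
  rw [hab, hcd] at hweight
  have harea : 2 * #C ≤ #(Icc a b) * #(Icc c d) + 1 :=
    (Nat.mul_le_mul_left 2 (card_le_card hbox)).trans two_mul_card_rotBox_le
  have hceil : ⌈2 * √(2 * (#C : ℝ) - 1)⌉ ≤ #(Icc a b) + #(Icc c d) := by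
    rw [Int.ceil_le]
    push_cast
    refine two_mul_sqrt_le_add (by positivity) (by positivity) ?_
    rw [sub_le_iff_le_add]
    exact_mod_cast harea
  lia

end RotBox

/-! ### The upper bounds -/

section UpperBound

variable {I : Image} {𝒞 : Finset (Finset (ℤ × ℤ))}

theorem sum_ite_mem_cells_le_one (h𝒞 : ∀ C ∈ 𝒞, IsComponent grid8 (whitePixels I) C)
    (z : ℤ × ℤ) : ∑ C ∈ 𝒞, (if z ∈ cells C then 1 else 0) ≤ 1 := by
  rw [sum_boole, Nat.cast_id, card_le_one]
  intro C hC D hD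
  rw [mem_filter, mem_cells] at hC hD
  obtain ⟨hC, x, hxC, hx⟩ := hC
  obtain ⟨hD, y, hyD, hy⟩ := hD
  obtain rfl | hxy := eq_or_grid8_adj_of_mem_cell hx hy
  · exact (h𝒞 C hC).eq_of_mem (h𝒞 D hD) hxC hyD
  · exact (h𝒞 C hC).eq_of_adj (h𝒞 D hD) hxC hyD hxy

open Classical in
theorem sum_diagonalWeight_le_card (h𝒞 : ∀ C ∈ 𝒞, IsComponent grid4 (whitePixels I) C)
    (z : ℤ × ℤ) : ∑ C ∈ 𝒞, diagonalWeight C z ≤ #{x ∈ cell z | x ∈ whitePixels I} := by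
  have hle : ∀ C, diagonalWeight C z ≤ ∑ x ∈ cell z, if x ∈ C then 1 else 0 := by
    intro C
    rw [cell, sum_insert (by simp [Prod.ext_iff]), sum_insert (by simp), sum_insert (by simp),
      sum_singleton, diagonalWeight]
    split_ifs <;> simp_all
  calc ∑ C ∈ 𝒞, diagonalWeight C z
      ≤ ∑ C ∈ 𝒞, ∑ x ∈ cell z, (if x ∈ C then 1 else 0) := sum_le_sum fun C _ => hle C
    _ = ∑ x ∈ cell z, ∑ C ∈ 𝒞, (if x ∈ C then 1 else 0) := sum_comm
    _ ≤ ∑ x ∈ cell z, (if x ∈ whitePixels I then 1 else 0) :=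
        sum_le_sum fun x _ => IsComponent.sum_ite_mem_le h𝒞 x
    _ = #{x ∈ cell z | x ∈ whitePixels I} := by rw [sum_boole, Nat.cast_id]

theorem diagonalWeight_le_two (C : Finset (ℤ × ℤ)) (z : ℤ × ℤ) : diagonalWeight C z ≤ 2 := by
  rw [diagonalWeight]
  split_ifs <;> simp

/- Once both diagonals of a cell have a white pixel, all its white pixels are in one component. -/
theorem IsComponent.mem_of_diagonalWeight_ne_zero {W : Set (ℤ × ℤ)} {C : Finset (ℤ × ℤ)}
    {x y z : ℤ × ℤ} (hC : IsComponent grid4 W C) (hxW : x ∈ W) (hyW : y ∈ W)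
    (hx : x = z ∨ x = z + (1, 1)) (hy : y = z + (1, 0) ∨ y = z + (0, 1))
    (hne : diagonalWeight C z ≠ 0) : x ∈ C := by
  have hadj : ∀ v w, (v = z ∨ v = z + (1, 1)) → (w = z + (1, 0) ∨ w = z + (0, 1)) →
      grid4.Adj v w := by
    rintro v w (rfl | rfl) (rfl | rfl) <;> simp [grid4_adj_iff]
  have hmem_anti : ∀ w ∈ C, (w = z + (1, 0) ∨ w = z + (0, 1)) → x ∈ C := fun w hwC hw =>
    hC.mem_of_adj hwC hxW (hadj x w hx hw).symm
  have hmem_main : ∀ v ∈ C, (v = z ∨ v = z + (1, 1)) → x ∈ C := fun v hvC hv =>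
    hmem_anti y (hC.mem_of_adj hvC hyW (hadj v y hv hy)) hy
  rw [diagonalWeight] at hne
  grind

theorem sum_diagonalWeight_le_two (h𝒞 : ∀ C ∈ 𝒞, IsComponent grid4 (whitePixels I) C)
    (z : ℤ × ℤ) : ∑ C ∈ 𝒞, diagonalWeight C z ≤ 2 := by
  classical
  have hpair : ∀ x y : ℤ × ℤ, {w ∈ cell z | w ∈ whitePixels I} ⊆ {x, y} →
      ∑ C ∈ 𝒞, diagonalWeight C z ≤ 2 := fun x y h =>
    (sum_diagonalWeight_le_card h𝒞 z).trans ((card_le_card h).trans card_le_two)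
  by_cases hmain : ∃ x ∈ whitePixels I, x = z ∨ x = z + (1, 1)
  swap
  · refine hpair (z + (1, 0)) (z + (0, 1)) fun w hw => ?_
    rw [mem_filter, mem_cell] at hw
    grind
  by_cases hanti : ∃ y ∈ whitePixels I, y = z + (1, 0) ∨ y = z + (0, 1)
  swap
  · refine hpair z (z + (1, 1)) fun w hw => ?_
    rw [mem_filter, mem_cell] at hw
    grind
  obtain ⟨x, hxI, hx⟩ := hmain
  obtain ⟨y, hyI, hy⟩ := hanti
  have hone := IsComponent.sum_ite_mem_le h𝒞 x
  rw [if_pos hxI] at hone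
  calc ∑ C ∈ 𝒞, diagonalWeight C z ≤ ∑ C ∈ 𝒞, 2 * (if x ∈ C then 1 else 0) := by
        refine sum_le_sum fun C hC => ?_
        split_ifs with hxC
        · exact diagonalWeight_le_two C z
        · have hzero := mt ((h𝒞 C hC).mem_of_diagonalWeight_ne_zero hxI hyI hx hy) hxC
          exact (not_not.1 hzero).le
    _ ≤ 2 := by
        rw [← mul_sum]
        lia

/-- The cells, represented by their least corners, with at most one white pixel. -/
def sparseCells (I : Image) : Set (ℤ × ℤ) :=
  {z | ((cell z : Set (ℤ × ℤ)) ∩ whitePixels I).Subsingleton}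

theorem sum_diagonalWeight_le_one (h𝒞 : ∀ C ∈ 𝒞, IsComponent grid4 (whitePixels I) C)
    {z : ℤ × ℤ} (hz : z ∈ sparseCells I) : ∑ C ∈ 𝒞, diagonalWeight C z ≤ 1 := by
  classical
  refine (sum_diagonalWeight_le_card h𝒞 z).trans (card_le_one.2 fun x hx y hy => ?_)
  exact hz (mem_filter.1 hx) (mem_filter.1 hy)

variable {j k : ℕ}

theorem le_F8 (hj : 1 ≤ j) (hk : j ≤ k) :
    (j : ℝ) / (j + ⌈2 * √(j : ℝ)⌉ + 1) ≤ F8 k (hj.trans hk) :=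
  le_sup' (fun j : ℕ => (j : ℝ) / (j + ⌈2 * √(j : ℝ)⌉ + 1)) (mem_Icc.2 ⟨hj, hk⟩)

theorem le_F4 (hj : 1 ≤ j) (hk : j ≤ k) :
    (j : ℝ) / (j + (⌈2 * √(2 * (j : ℝ) - 1)⌉ : ℝ) / 2) ≤ F4 k (hj.trans hk) :=
  le_sup' (fun j : ℕ => (j : ℝ) / (j + (⌈2 * √(2 * (j : ℝ) - 1)⌉ : ℝ) / 2)) (mem_Icc.2 ⟨hj, hk⟩)

theorem ceil_two_mul_sqrt_nonneg (x : ℝ) : (0 : ℝ) ≤ ⌈2 * √x⌉ := by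
  exact_mod_cast Int.ceil_nonneg (by positivity)

theorem F8_nonneg (hk : 1 ≤ k) : 0 ≤ F8 k hk := by
  refine le_trans ?_ (le_F8 le_rfl hk)
  have := ceil_two_mul_sqrt_nonneg ((1 : ℕ) : ℝ)
  positivity

theorem F4_nonneg (hk : 1 ≤ k) : 0 ≤ F4 k hk := by
  refine le_trans ?_ (le_F4 le_rfl hk)
  have := ceil_two_mul_sqrt_nonneg (2 * ((1 : ℕ) : ℝ) - 1)
  positivity

theorem density_le_F8 (hk : 1 ≤ k) (hI : WhiteComponentsLE grid8 k I) : density I ≤ F8 k hk := by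
  rw [← mul_one (F8 k hk)]
  refine hI.density_le le_rfl (fun C z => if z ∈ cells C then 1 else 0) (F8_nonneg hk)
    (fun C hC => ?_) fun 𝒞 h𝒞 z => by exact_mod_cast sum_ite_mem_cells_le_one h𝒞 z
  have hcells : (#C + ⌈2 * √(#C : ℝ)⌉ + 1 : ℝ) ≤ #(cells C) := by
    exact_mod_cast ceil_add_card_le_card_cells hC.nonempty
  have hF := le_F8 hC.nonempty.card_pos (hI.card_le hC)
  have hceil := ceil_two_mul_sqrt_nonneg (#C : ℝ)
  rw [div_le_iff₀ (by positivity)] at hF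
  simpa using hF.trans (mul_le_mul_of_nonneg_left hcells (F8_nonneg hk))

theorem density_le_F4 (hk : 1 ≤ k) (hI : WhiteComponentsLE grid4 k I) : density I ≤ F4 k hk := by
  have hF := F4_nonneg hk
  rw [← div_mul_cancel₀ (F4 k hk) two_ne_zero]
  refine hI.density_le grid4_le_grid8 diagonalWeight (by positivity)
    (fun C hC => ?_) fun 𝒞 h𝒞 z => by exact_mod_cast sum_diagonalWeight_le_two h𝒞 z
  have hweight : (2 * #C + ⌈2 * √(2 * (#C : ℝ) - 1)⌉ : ℝ) ≤
      ∑ z ∈ cells C, (diagonalWeight C z : ℝ) := by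
    exact_mod_cast hC.ceil_add_card_le_sum_diagonalWeight
  have hle := le_F4 hC.nonempty.card_pos (hI.card_le hC)
  have hceil := ceil_two_mul_sqrt_nonneg (2 * (#C : ℝ) - 1)
  have hpos : (0 : ℝ) < #C := by exact_mod_cast hC.nonempty.card_pos
  rw [div_le_iff₀ (by positivity)] at hle
  linarith [mul_le_mul_of_nonneg_left hweight hF]

end UpperBound

/-! ### Rotated boxes with one even and one odd side do not tile -/

/-- In the rotated coordinates `u = x + y`, `v = x - y`, the pixels of the box `[a, b] × [c, d]`
satisfy `w` and their 4-neighbours outside it do not. Pixels are the pairs with even `u + v`;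
the values of `w` at other pairs are irrelevant. -/
structure IsRotTile (w : ℤ → ℤ → Prop) (a b c d : ℤ) : Prop where
  white : ∀ u v, 2 ∣ u + v → (a ≤ u ∧ u ≤ b) ∧ (c ≤ v ∧ v ≤ d) → w u v
  black : ∀ u v u' v', 2 ∣ u + v → (a ≤ u ∧ u ≤ b) ∧ (c ≤ v ∧ v ≤ d) →
    (u' = u + 1 ∨ u' = u - 1) ∧ (v' = v + 1 ∨ v' = v - 1) →
    ¬((a ≤ u' ∧ u' ≤ b) ∧ (c ≤ v' ∧ v' ≤ d)) → ¬w u' v'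

/-- In rotated coordinates and within distance `R` of `(u₀, v₀)`, every cell has at least two white
pixels (equivalently, no three black ones) and every white pixel lies in a tile with side lengths
`e` and `o`. A cell is indexed by its centre, a pair with odd `u + v`. -/
structure LocallyTiled (w : ℤ → ℤ → Prop) (e o R u₀ v₀ : ℤ) : Prop where
  cell : ∀ u v, ¬2 ∣ u + v → (u₀ - R ≤ u ∧ u ≤ u₀ + R) ∧ (v₀ - R ≤ v ∧ v ≤ v₀ + R) →
    (w (u - 1) v ∨ w (u + 1) v ∨ w u (v - 1)) ∧ (w (u - 1) v ∨ w (u + 1) v ∨ w u (v + 1)) ∧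
    (w (u - 1) v ∨ w u (v - 1) ∨ w u (v + 1)) ∧ (w (u + 1) v ∨ w u (v - 1) ∨ w u (v + 1))
  tile : ∀ u v, 2 ∣ u + v → (u₀ - R ≤ u ∧ u ≤ u₀ + R) ∧ (v₀ - R ≤ v ∧ v ≤ v₀ + R) → w u v →
    ∃ a b c d, ((a ≤ u ∧ u ≤ b) ∧ (c ≤ v ∧ v ≤ d)) ∧ IsRotTile w a b c d ∧
      ((b + 1 = a + e ∧ d + 1 = c + o) ∨ (b + 1 = a + o ∧ d + 1 = c + e))

section Tiling

variable {w : ℤ → ℤ → Prop} {e o R u₀ v₀ a b c d : ℤ}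

theorem IsRotTile.swap (h : IsRotTile w a b c d) : IsRotTile (fun u v => w v u) c d a b where
  white u v hp huv := h.white v u (by omega) huv.symm
  black u v u' v' hp huv hadj hout :=
    h.black v u v' u' (by omega) huv.symm hadj.symm fun hin => hout hin.symm

theorem IsRotTile.neg_left (h : IsRotTile w a b c d) :
    IsRotTile (fun u v => w (-u) v) (-b) (-a) c d where
  white u v hp huv := h.white (-u) v (by omega) (by omega)
  black u v u' v' hp huv hadj hout :=
    h.black (-u) v (-u') v' (by omega) (by omega) (by omega) (by omega)

namespace LocallyTiled

theorem swap (h : LocallyTiled w e o R u₀ v₀) :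
    LocallyTiled (fun u v => w v u) e o R v₀ u₀ where
  cell u v hp huv := by
    have hcell := h.cell v u (by omega) huv.symm
    grind
  tile u v hp huv hw := by
    obtain ⟨a, b, c, d, hmem, ht, hside⟩ := h.tile v u (by omega) huv.symm hw
    exact ⟨c, d, a, b, hmem.symm, ht.swap, by omega⟩

theorem neg_left (h : LocallyTiled w e o R u₀ v₀) :
    LocallyTiled (fun u v => w (-u) v) e o R (-u₀) v₀ where
  cell u v hp huv := by
    have hcell := h.cell (-u) v (by omega) (by omega)
    rw [← neg_add', neg_add_eq_sub, ← neg_sub u 1] at hcell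
    grind
  tile u v hp huv hw := by
    obtain ⟨a, b, c, d, hmem, ht, hside⟩ := h.tile (-u) v (by omega) (by omega) hw
    exact ⟨-b, -a, c, d, by omega, ht.neg_left, by omega⟩

/-- The tile that covers the cell cut off by the corner `(b, c)` has `c - 1` as its upper bound
for `v`. -/
theorem not_white_above_corner (h : LocallyTiled w e o R u₀ v₀) (ht : IsRotTile w a b c d)
    (hab : a < b) (hcd : c < d) (hpar : ¬2 ∣ b + c)
    (hnear : (u₀ - R + 3 ≤ b ∧ b ≤ u₀ + R - 3) ∧ (v₀ - R + 3 ≤ c ∧ c ≤ v₀ + R - 3)) :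
    ¬w (b + 3) c := by
  have hleft : ¬w b (c - 1) :=
    ht.black (b - 1) c b (c - 1) (by omega) (by omega) (by omega) (by omega)
  have htop : ¬w (b + 1) c :=
    ht.black b (c + 1) (b + 1) c (by omega) (by omega) (by omega) (by omega)
  have hcell := h.cell (b + 1) (c - 1) (by omega) (by omega)
  rw [show b + 1 - 1 = b by ring, show b + 1 + 1 = b + 2 by ring, show c - 1 - 1 = c - 2 by ring,
    show c - 1 + 1 = c by ring] at hcell
  have hright : w (b + 2) (c - 1) := by grind
  have hbottom : w (b + 1) (c - 2) := by grind
  obtain ⟨a₁, b₁, c₁, d₁, hmem, ht₁, -⟩ := h.tile (b + 2) (c - 1) (by omega) (by omega) hright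
  have hmem' : (a₁ ≤ b + 1 ∧ b + 1 ≤ b₁) ∧ (c₁ ≤ c - 2 ∧ c - 2 ≤ d₁) := by
    by_contra hout
    exact ht₁.black (b + 2) (c - 1) (b + 1) (c - 2) (by omega) hmem (by omega) hout hbottom
  have hd₁ : d₁ = c - 1 := by
    by_contra hne
    exact htop (ht₁.white (b + 1) c (by omega) (by omega))
  exact ht₁.black (b + 2) (c - 1) (b + 3) c (by omega) hmem (by omega) (by omega)

theorem exists_corner_tile (h : LocallyTiled w e o R u₀ v₀) (he : 2 ≤ e) (ho : 2 ≤ o)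
    (ht : IsRotTile w a b c d) (hab : a < b) (hcd : c < d) (hpar : ¬2 ∣ b + c)
    (hnear : (u₀ - R + 3 ≤ b ∧ b ≤ u₀ + R - 3) ∧ (v₀ - R + 3 ≤ c ∧ c ≤ v₀ + R - 3)) :
    ∃ b' d', IsRotTile w (b + 2) b' (c + 1) d' ∧
      ((b' + 1 = b + 2 + e ∧ d' + 1 = c + 1 + o) ∨ (b' + 1 = b + 2 + o ∧ d' + 1 = c + 1 + e)) := by
  have hblack₁ : ¬w (b + 1) c :=
    ht.black b (c + 1) (b + 1) c (by omega) (by omega) (by omega) (by omega)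
  have hblack₂ : ¬w (b + 1) (c + 2) :=
    ht.black b (c + 1) (b + 1) (c + 2) (by omega) (by omega) (by omega) (by omega)
  have hblack₃ : ¬w (b + 3) c := h.not_white_above_corner ht hab hcd hpar hnear
  have hcell := h.cell (b + 2) c (by omega) (by omega)
  rw [show b + 2 - 1 = b + 1 by ring, show b + 2 + 1 = b + 3 by ring] at hcell
  have hcorner : w (b + 2) (c + 1) := by grind
  obtain ⟨a', b', c', d', hmem, ht', hside⟩ :=
    h.tile (b + 2) (c + 1) (by omega) (by omega) hcorner
  have hout₁ := mt (ht'.white (b + 1) c (by omega)) hblack₁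
  have hout₂ := mt (ht'.white (b + 1) (c + 2) (by omega)) hblack₂
  have hout₃ := mt (ht'.white (b + 3) c (by omega)) hblack₃
  obtain rfl : a' = b + 2 := by omega
  obtain rfl : c' = c + 1 := by omega
  exact ⟨b', d', ht', hside⟩

/-- The tiles forced at the two ends of the truncated side `u = b` collide. -/
theorem two_dvd_of_isRotTile (h : LocallyTiled w e o R u₀ v₀) (he : 2 ≤ e) (ho : 3 ≤ o)
    (hodd : ¬2 ∣ o) (heo : o ≤ e + 1) (ht : IsRotTile w a b c d)
    (hab : b + 1 = a + e) (hcd : d + 1 = c + o)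
    (hnear : (u₀ - R + 3 ≤ b ∧ b ≤ u₀ + R - 3) ∧ (v₀ - R + 3 ≤ c ∧ d ≤ v₀ + R - 3)) :
    2 ∣ b + c := by
  by_contra hpar
  obtain ⟨b₁, d₁, ht₁, hside₁⟩ := h.exists_corner_tile he (by omega) ht (by omega) (by omega) hpar
    (by omega)
  obtain ⟨b₂, d₂, ht₂, hside₂⟩ := h.swap.neg_left.swap.exists_corner_tile he (by omega)
    ht.swap.neg_left.swap (by omega) (by omega) (by omega) (by omega)
  have hwhite : w (b + 3) d := ht₁.white _ _ (by omega) (by omega)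
  have hblack := ht₂.black (b + 2) (-d + 1) (b + 3) (-d) (by omega) (by omega) (by omega) (by omega)
  rw [neg_neg] at hblack
  exact hblack hwhite

theorem false_of_isRotTile (h : LocallyTiled w e o R u₀ v₀) (he : 2 ≤ e) (heven : 2 ∣ e)
    (ho : 3 ≤ o) (hodd : ¬2 ∣ o) (heo : o ≤ e + 1) (hR : e + 3 ≤ R ∧ o + 3 ≤ R)
    (ht : IsRotTile w a b c d) (hab : b + 1 = a + e) (hcd : d + 1 = c + o)
    (hmem : (a ≤ u₀ ∧ u₀ ≤ b) ∧ (c ≤ v₀ ∧ v₀ ≤ d)) : False := by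
  have hright := h.two_dvd_of_isRotTile he ho hodd heo ht hab hcd (by omega)
  have hleft := h.neg_left.two_dvd_of_isRotTile he ho hodd heo ht.neg_left (by omega) hcd (by omega)
  omega

theorem not_white (h : LocallyTiled w e o R u₀ v₀) (he : 2 ≤ e) (heven : 2 ∣ e) (ho : 3 ≤ o)
    (hodd : ¬2 ∣ o) (heo : o ≤ e + 1) (hR : e + 3 ≤ R ∧ o + 3 ≤ R) (hpar : 2 ∣ u₀ + v₀) :
    ¬w u₀ v₀ := by
  intro hw
  obtain ⟨a, b, c, d, hmem, ht, hside | hside⟩ := h.tile u₀ v₀ hpar (by omega) hw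
  · exact h.false_of_isRotTile he heven ho hodd heo hR ht hside.1 hside.2 hmem
  · exact h.swap.false_of_isRotTile he heven ho hodd heo hR ht.swap hside.2 hside.1 hmem.symm

end LocallyTiled

end Tiling

/-- The pixel with rotated coordinates `u = x + y` and `v = x - y`; a junk value for odd `u + v`. -/
def rotPixel (u v : ℤ) : ℤ × ℤ := ((u + v) / 2, (u - v) / 2)

/-- Membership in `W`, as a predicate of rotated coordinates. -/
def RotMem (W : Set (ℤ × ℤ)) (u v : ℤ) : Prop := rotPixel u v ∈ W

theorem rotPixel_add_sub (x : ℤ × ℤ) : rotPixel (x.1 + x.2) (x.1 - x.2) = x := by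
  ext <;> simp only [rotPixel] <;> omega

theorem rotPixel_mem_rotBox_iff {u v a b c d : ℤ} (hp : 2 ∣ u + v) :
    rotPixel u v ∈ rotBox a b c d ↔ (a ≤ u ∧ u ≤ b) ∧ (c ≤ v ∧ v ≤ d) := by
  rw [mem_rotBox, rotPixel]
  lia

theorem cell_eq_rotPixel (u v : ℤ) :
    cell ((u + v - 1) / 2, (u - v - 1) / 2) =
      {rotPixel (u - 1) v, rotPixel u (v + 1), rotPixel u (v - 1), rotPixel (u + 1) v} := by
  ext ⟨x, y⟩
  simp only [mem_cell, rotPixel, mem_insert, mem_singleton, Prod.mk_add_mk, Prod.mk.injEq]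
  omega

theorem IsComponent.isRotTile {W : Set (ℤ × ℤ)} {a b c d : ℤ}
    (hC : IsComponent grid4 W (rotBox a b c d)) :
    IsRotTile (RotMem W) a b c d where
  white u v hp huv := hC.mem_of_mem ((rotPixel_mem_rotBox_iff hp).2 huv)
  black u v u' v' hp huv hadj hout hw := by
    have hgrid : grid4.Adj (rotPixel u v) (rotPixel u' v') := by
      simp only [grid4_adj_iff, rotPixel, Int.abs_eq_natAbs]
      omega
    have hmem := hC.mem_of_adj ((rotPixel_mem_rotBox_iff hp).2 huv) hw hgrid
    exact hout ((rotPixel_mem_rotBox_iff (by omega)).1 hmem)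

/-- `C` is a full rotated box with side lengths `e` and `o`. -/
def IsFullBox (e o : ℕ) (C : Finset (ℤ × ℤ)) : Prop :=
  ∃ a b c d : ℤ, C = rotBox a b c d ∧
    ((b + 1 = a + e ∧ d + 1 = c + o) ∨ (b + 1 = a + o ∧ d + 1 = c + e))

/-- The white pixels of `I` whose component is not a full rotated box with side lengths `e` and
`o`. -/
def irregularPixels (I : Image) (e o : ℕ) : Set (ℤ × ℤ) :=
  {x ∈ whitePixels I | ∀ C, IsComponent grid4 (whitePixels I) C → x ∈ C → ¬IsFullBox e o C}

section Irregular

variable {I : Image} {e o : ℕ}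

theorem rotMem_of_cell_notMem_sparseCells {u v : ℤ}
    (hcell : ((u + v - 1) / 2, (u - v - 1) / 2) ∉ sparseCells I) :
    let w := RotMem (whitePixels I)
    (w (u - 1) v ∨ w (u + 1) v ∨ w u (v - 1)) ∧ (w (u - 1) v ∨ w (u + 1) v ∨ w u (v + 1)) ∧
    (w (u - 1) v ∨ w u (v - 1) ∨ w u (v + 1)) ∧ (w (u + 1) v ∨ w u (v - 1) ∨ w u (v + 1)) := by
  rw [sparseCells, Set.mem_ofPred_eq, Set.not_subsingleton_iff, cell_eq_rotPixel] at hcell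
  obtain ⟨p, ⟨hp, hpw⟩, q, ⟨hq, hqw⟩, hne⟩ := hcell
  rw [mem_coe, mem_insert, mem_insert, mem_insert, mem_singleton] at hp hq
  grind [RotMem]

theorem exists_isRotTile_of_notMem_irregularPixels {u v : ℤ} (hp : 2 ∣ u + v)
    (hwhite : RotMem (whitePixels I) u v) (hreg : rotPixel u v ∉ irregularPixels I e o) :
    ∃ a b c d, ((a ≤ u ∧ u ≤ b) ∧ (c ≤ v ∧ v ≤ d)) ∧
      IsRotTile (RotMem (whitePixels I)) a b c d ∧
      ((b + 1 = a + e ∧ d + 1 = c + o) ∨ (b + 1 = a + o ∧ d + 1 = c + e)) := by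
  simp only [irregularPixels, Set.mem_sep_iff, not_and, not_forall, not_not] at hreg
  obtain ⟨C, hC, hmem, a, b, c, d, rfl, hside⟩ := hreg hwhite
  exact ⟨a, b, c, d, (rotPixel_mem_rotBox_iff hp).1 hmem, hC.isRotTile, hside⟩

theorem locallyTiled_of_notMem {x : ℤ × ℤ} {R : ℕ}
    (h : ∀ y : ℤ × ℤ, |y.1 - x.1| ≤ R + 1 → |y.2 - x.2| ≤ R + 1 →
      y ∉ irregularPixels I e o ∪ sparseCells I) :
    LocallyTiled (RotMem (whitePixels I)) e o R (x.1 + x.2) (x.1 - x.2) where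
  cell u v _ huv := by
    have hmem := h ((u + v - 1) / 2, (u - v - 1) / 2) (abs_le.2 (by omega)) (abs_le.2 (by omega))
    exact rotMem_of_cell_notMem_sparseCells fun hs => hmem (Or.inr hs)
  tile u v hp huv hw := by
    have hmem := h (rotPixel u v) (abs_le.2 (by simp only [rotPixel]; omega))
      (abs_le.2 (by simp only [rotPixel]; omega))
    exact exists_isRotTile_of_notMem_irregularPixels hp hw fun hi => hmem (Or.inl hi)

theorem isDenseAtScale_irregularPixels_union_sparseCells (I : Image) (he : 2 ≤ e) (heven : Even e)
    (ho : 3 ≤ o) (hodd : Odd o) (heo : o ≤ e + 1) :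
    IsDenseAtScale (irregularPixels I e o ∪ sparseCells I) (e + o + 5) := by
  intro z
  by_contra! hcon
  have hz : z ∉ sparseCells I := by
    intro hz
    have hfar := hcon z (Or.inr hz)
    rw [sub_self, sub_self, abs_zero] at hfar
    omega
  rw [sparseCells, Set.mem_ofPred_eq, Set.not_subsingleton_iff] at hz
  obtain ⟨x, ⟨hx, hwhite⟩, -⟩ := hz
  have hloc : LocallyTiled (RotMem (whitePixels I)) e o (e + o + 3 : ℕ)
      (x.1 + x.2) (x.1 - x.2) := by
    refine locallyTiled_of_notMem fun y hy₁ hy₂ hy => ?_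
    rw [abs_le] at hy₁ hy₂
    have hxz : (z.1 ≤ x.1 ∧ x.1 ≤ z.1 + 1) ∧ (z.2 ≤ x.2 ∧ x.2 ≤ z.2 + 1) := by
      rw [mem_coe, mem_cell] at hx
      rcases hx with rfl | rfl | rfl | rfl <;> simp
    exact (hcon y hy (abs_le.2 (by omega))).not_ge (abs_le.2 (by omega))
  rw [even_iff_two_dvd] at heven
  rw [← Nat.not_even_iff_odd, even_iff_two_dvd] at hodd
  refine hloc.not_white (by omega) (by omega) (by omega) (by omega) (by omega) (by omega)
    (by omega) ?_
  rwa [RotMem, rotPixel_add_sub]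

end Irregular

section NearSquareBox

variable {e o s k j p q : ℤ}

theorem mul_lt_mul_of_sq_add_four {j s t w : ℤ} (hw : 5 ≤ w) (hs : 8 * s = w ^ 2 - 1) (ht : 2 ≤ t)
    (htw : t < w) (hj : 8 * j ≤ t ^ 2 + 4) : j * w < s * t := by
  obtain hw5 | hw7 : w = 5 ∨ 7 ≤ w := by
    rcases (show w = 5 ∨ w = 6 ∨ 7 ≤ w by omega) with rfl | rfl | hw
    · exact Or.inl rfl
    · omega
    · exact Or.inr hw
  · subst hw5
    obtain rfl | rfl | rfl : t = 2 ∨ t = 3 ∨ t = 4 := by omega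
    all_goals omega
  · have hmul : (t ^ 2 + 4) * w < (w ^ 2 - 1) * t := by
      nlinarith [mul_nonneg (mul_nonneg (sub_nonneg.2 ht) (show 0 ≤ w - 1 - t by omega))
        (show 0 ≤ w by omega), mul_nonneg (show 0 ≤ w - 1 - t by omega) (show 0 ≤ w + 1 by omega),
        mul_nonneg (show 0 ≤ w by omega) (sub_nonneg.2 hw7)]
    nlinarith

theorem mul_add_lt_or_eq (he : 2 ≤ e) (ho : 3 ≤ o) (heo : o = e + 1 ∨ e = o + 1)
    (hs : 2 * s = e * o) (hk : k * (e + o) < s * (e + o + 1)) (hjk : j ≤ k) (hp : 1 ≤ p)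
    (hq : 1 ≤ q) (hj : 2 * j ≤ p * q + 1) :
    j * (e + o) < s * (p + q) ∨ (j = s ∧ p + q = e + o) := by
  have h8s : 8 * s = (e + o) ^ 2 - 1 := by
    rcases heo with rfl | rfl <;> linarith
  have h8j : 8 * j + (p - q) ^ 2 ≤ (p + q) ^ 2 + 4 := by linarith
  rcases lt_trichotomy (p + q) (e + o) with hlt | heq | hgt
  · exact Or.inl (mul_lt_mul_of_sq_add_four (by omega) h8s (by omega) hlt
      (by linarith [sq_nonneg (p - q)]))
  · have hpq : 0 < (p - q) ^ 2 := sq_pos_of_ne_zero (by omega)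
    obtain hjs | hjs : j < s ∨ j = s := lt_or_eq_of_le (by rw [heq] at h8j; omega)
    · left
      rw [heq]
      nlinarith
    · exact Or.inr ⟨hjs, heq⟩
  · have hs0 : 0 ≤ s := by nlinarith
    left
    calc j * (e + o) ≤ k * (e + o) := mul_le_mul_of_nonneg_right hjk (by omega)
      _ < s * (e + o + 1) := hk
      _ ≤ s * (p + q) := mul_le_mul_of_nonneg_left hgt hs0

theorem eq_or_eq_of_add_eq_of_mul_le (heo : o = e + 1 ∨ e = o + 1) (hadd : p + q = e + o)
    (hmul : e * o ≤ p * q + 1) : (p = e ∧ q = o) ∨ (p = o ∧ q = e) := by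
  obtain rfl : q = e + o - p := by omega
  have hle : (p - e) * (p - o) ≤ 1 := by linarith
  suffices p = e ∨ p = o by omega
  by_contra! hne
  rcases lt_or_gt_of_ne hne.1 with hpe | hpe <;> rcases lt_or_gt_of_ne hne.2 with hpo | hpo
  · rcases heo with rfl | rfl <;> nlinarith
  · omega
  · omega
  · rcases heo with rfl | rfl <;> nlinarith

end NearSquareBox

theorem IsComponent.mul_card_lt_or_isFullBox {W : Set (ℤ × ℤ)} {C : Finset (ℤ × ℤ)} {e o s k : ℕ}
    (hC : IsComponent grid4 W C) (he : 2 ≤ e) (heven : Even e) (ho : 3 ≤ o)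
    (heo : o = e + 1 ∨ e = o + 1) (hs : 2 * s = e * o) (hk : k * (e + o) < s * (e + o + 1))
    (hCk : #C ≤ k) :
    (2 * s + (e + o)) * #C < s * ∑ z ∈ cells C, diagonalWeight C z ∨
      ((2 * s + (e + o)) * #C ≤ s * ∑ z ∈ cells C, diagonalWeight C z ∧ IsFullBox e o C) := by
  obtain ⟨a, b, c, d, hab, hcd, hbox⟩ := hC.exists_subset_rotBox
  have hweight := card_add_card_image_le_sum_diagonalWeight C
  have hp := (hC.nonempty.image fun z => z.1 + z.2).card_pos
  have hq := (hC.nonempty.image fun z => z.1 - z.2).card_pos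
  rw [hab] at hweight hp
  rw [hcd] at hweight hq
  have hweight' := Nat.mul_le_mul_left s hweight
  have harea : 2 * #C ≤ #(Icc a b) * #(Icc c d) + 1 :=
    (Nat.mul_le_mul_left 2 (card_le_card hbox)).trans two_mul_card_rotBox_le
  have hcases := mul_add_lt_or_eq (e := e) (o := o) (s := s) (k := k) (j := #C) (p := #(Icc a b))
    (q := #(Icc c d)) (by omega) (by omega) (by omega) (by exact_mod_cast hs)
    (by exact_mod_cast hk) (by omega) (by omega) (by omega) (by exact_mod_cast harea)
  norm_cast at hcases
  obtain hlt | ⟨hCs, hadd⟩ := hcases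
  · exact Or.inl (by linarith)
  refine Or.inr ⟨by rw [hCs]; nlinarith, a, b, c, d, ?_⟩
  have hside := eq_or_eq_of_add_eq_of_mul_le (e := e) (o := o) (p := #(Icc a b))
    (q := #(Icc c d)) (by omega) (by exact_mod_cast hadd)
    (by rw [hCs, hs] at harea; exact_mod_cast harea)
  norm_cast at hside
  have hfull : 2 * #(rotBox a b c d) = e * o := by
    rw [two_mul_card_rotBox_of_even (by grind)]
    grind
  exact ⟨eq_of_subset_of_card_le hbox (by omega), by grind [Int.card_Icc]⟩

open Classical in
theorem IsComponent.card_add_card_irregular_le {I : Image} {C : Finset (ℤ × ℤ)} {e o s k : ℕ}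
    (hC : IsComponent grid4 (whitePixels I) C) (he : 2 ≤ e) (heven : Even e) (ho : 3 ≤ o)
    (heo : o = e + 1 ∨ e = o + 1) (hs : 2 * s = e * o) (hk : k * (e + o) < s * (e + o + 1))
    (hCk : #C ≤ k) :
    #C + 1 / (k * (2 * s + (e + o)) : ℝ) * #{x ∈ C | x ∈ irregularPixels I e o} ≤
      s / (2 * s + (e + o) : ℝ) * ∑ z ∈ cells C, (diagonalWeight C z : ℝ) := by
  have hL : (0 : ℝ) < 2 * s + (e + o) := by positivity
  have hk0 : (0 : ℝ) < k := by exact_mod_cast hC.nonempty.card_pos.trans_le hCk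
  rw [div_mul_eq_mul_div, div_mul_eq_mul_div, one_mul, le_div_iff₀ hL, add_mul, ← div_div,
    div_mul_cancel₀ _ hL.ne']
  obtain hlt | ⟨hle, hfull⟩ := hC.mul_card_lt_or_isFullBox he heven ho heo hs hk hCk
  · have hlt : (2 * s + (e + o)) * (#C : ℝ) + 1 ≤ s * ∑ z ∈ cells C, (diagonalWeight C z : ℝ) := by
      exact_mod_cast hlt
    have hirr : (#{x ∈ C | x ∈ irregularPixels I e o} : ℝ) / k ≤ 1 := by
      rw [div_le_one hk0]
      exact_mod_cast (card_filter_le _ _).trans hCk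
    linarith
  · have hle : (2 * s + (e + o)) * (#C : ℝ) ≤ s * ∑ z ∈ cells C, (diagonalWeight C z : ℝ) := by
      exact_mod_cast hle
    rw [filter_eq_empty_iff.2 fun x hx hirr => hirr.2 C hC hx hfull, card_empty, Nat.cast_zero,
      zero_div]
    linarith

/-- Full boxes attain the bound but do not tile, so a positive proportion of the pixels is
irregular or of the cells sparse, and each of these costs a fixed amount. -/
theorem exists_lt_forall_density_le {e o s k : ℕ} (he : 2 ≤ e) (heven : Even e) (ho : 3 ≤ o)
    (heo : o = e + 1 ∨ e = o + 1) (hs : 2 * s = e * o) (hk : k * (e + o) < s * (e + o + 1))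
    (hk1 : 1 ≤ k) :
    ∃ θ : ℝ, θ < 2 * (s : ℝ) / (2 * s + (e + o)) ∧
      ∀ I, WhiteComponentsLE grid4 k I → density I ≤ θ := by
  classical
  have hs1 : (1 : ℝ) ≤ s := by
    have : 1 ≤ s := by nlinarith
    exact_mod_cast this
  have hk0 : (1 : ℝ) ≤ k := by exact_mod_cast hk1
  have hodd : Odd o := by grind
  set L : ℝ := 2 * s + (e + o)
  have hL0 : 0 < L := by positivity
  have hδμ : 1 / (k * L) ≤ s / L := by
    rw [← div_div, div_le_div_iff_of_pos_right hL0, div_le_iff₀ (by positivity)]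
    nlinarith
  refine ⟨s / L * 2 - 1 / (k * L) / (2 * (e + o + 5 : ℕ) + 1) ^ 2, ?_, fun I hI => ?_⟩
  · rw [div_mul_eq_mul_div, mul_comm (s : ℝ)]
    exact sub_lt_self _ (by positivity)
  refine hI.density_le_sub grid4_le_grid8 diagonalWeight (by positivity) hδμ (fun x hx => hx.1)
    (fun C hC => hC.card_add_card_irregular_le he heven ho heo hs hk (hI.card_le hC))
    (fun 𝒞 h𝒞 z => ?_)
    (isDenseAtScale_irregularPixels_union_sparseCells I he heven ho hodd (by omega))
  split_ifs with hz
  · have : (∑ C ∈ 𝒞, diagonalWeight C z : ℝ) ≤ 1 := by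
      exact_mod_cast sum_diagonalWeight_le_one h𝒞 hz
    linarith
  · rw [add_zero]
    exact_mod_cast sum_diagonalWeight_le_two h𝒞 z

/-! ### Periodic images -/

theorem exists_abs_le_natCast {ι : Type*} [Finite ι] (g : ι → ℤ × ℤ) :
    ∃ K : ℕ, ∀ i, |(g i).1| ≤ K ∧ |(g i).2| ≤ K := by
  obtain ⟨K, hK⟩ := Finite.exists_le fun i => max (g i).1.natAbs (g i).2.natAbs
  refine ⟨K, fun i => ?_⟩
  have := hK i
  simp only [Int.abs_eq_natAbs]
  lia

section Translates

variable {ι : Type*} [Fintype ι] {I : Image}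

theorem sq_mul_le_card_mul_boxCount {A : Set (ℤ × ℤ)} {g : ι → ℤ × ℤ} {K r : ℕ}
    (hg : ∀ i, |(g i).1| ≤ K ∧ |(g i).2| ≤ K) (h : ∀ z, r ≤ {i | z + g i ∈ A}.ncard) (l : ℕ) :
    (2 * l + 1) ^ 2 * r ≤ Fintype.card ι * boxCount A (K + l) := by
  classical
  have htranslate : ∀ i, #{z ∈ boxFinset l | z + g i ∈ A} ≤ boxCount A (K + l) := by
    intro i
    refine card_le_card_of_injOn (· + g i) (fun z hz => ?_) (add_left_injective (g i)).injOn
    obtain ⟨hzl, hzA⟩ := mem_filter.1 hz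
    obtain ⟨hg1, hg2⟩ := hg i
    rw [abs_le] at hg1 hg2
    rw [mem_boxFinset] at hzl
    simp only [coe_filter, Set.mem_ofPred_eq, mem_boxFinset, Prod.fst_add, Prod.snd_add]
    exact ⟨by push_cast; lia, hzA⟩
  calc (2 * l + 1) ^ 2 * r = ∑ _z ∈ boxFinset l, r := by
        rw [sum_const, card_boxFinset, smul_eq_mul]
    _ ≤ ∑ z ∈ boxFinset l, #{i | z + g i ∈ A} := by
        refine sum_le_sum fun z _ => (h z).trans_eq ?_
        rw [Set.ncard_eq_toFinset_card', Set.toFinset_ofPred]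
    _ = ∑ i, #{z ∈ boxFinset l | z + g i ∈ A} :=
        sum_card_bipartiteAbove_eq_sum_card_bipartiteBelow fun z i => z + g i ∈ A
    _ ≤ Fintype.card ι * boxCount A (K + l) := by
        simpa using sum_le_card_nsmul univ _ _ fun i _ => htranslate i

theorem div_card_le_density [Nonempty ι] (g : ι → ℤ × ℤ) {r : ℕ}
    (h : ∀ z, r ≤ {i | z + g i ∈ whitePixels I}.ncard) :
    (r : ℝ) / Fintype.card ι ≤ density I := by
  obtain ⟨K, hK⟩ := exists_abs_le_natCast g
  have hlim := (tendsto_box_ratio (1 - 2 * K)).const_mul ((r : ℝ) / Fintype.card ι)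
  rw [mul_one] at hlim
  refine le_density_of_tendsto ?_ hlim
  filter_upwards [eventually_ge_atTop K] with m hm
  obtain ⟨l, rfl⟩ := Nat.exists_eq_add_of_le hm
  have hside : 2 * ((K + l : ℕ) : ℝ) + (1 - 2 * K) = 2 * l + 1 := by push_cast; ring
  have hcount : (2 * (l : ℝ) + 1) ^ 2 * r ≤
      Fintype.card ι * boxCount (whitePixels I) (K + l) := by
    exact_mod_cast sq_mul_le_card_mul_boxCount hK h l
  have hcard : (0 : ℝ) < Fintype.card ι := by exact_mod_cast Fintype.card_pos
  rw [← mul_div_assoc, hside, div_mul_eq_mul_div]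
  gcongr
  rw [div_le_iff₀ hcard]
  linarith

end Translates

theorem whiteComponentsLE_of_closed {G : SimpleGraph (ℤ × ℤ)} {I : Image} {k : ℕ}
    (h : ∀ x ∈ whitePixels I, ∃ A : Finset (ℤ × ℤ), x ∈ A ∧ #A ≤ k ∧
      ∀ y ∈ A, ∀ z ∈ whitePixels I, G.Adj y z → z ∈ A) : WhiteComponentsLE G k I := by
  intro C
  obtain ⟨x, hx⟩ := C.nonempty_supp
  obtain ⟨A, hxA, hA, hclosed⟩ := h x x.2
  have hwalk : ∀ a b : whitePixels I, (G.induce (whitePixels I)).Walk a b →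
      (a : ℤ × ℤ) ∈ A → (b : ℤ × ℤ) ∈ A := by
    intro a b w
    induction w with
    | nil => exact id
    | cons hab _ ih => exact fun ha => ih (hclosed _ ha _ (Subtype.prop _) hab)
  have hsupp : Subtype.val '' C.supp ⊆ (A : Set (ℤ × ℤ)) := by
    rintro _ ⟨y, hy, rfl⟩
    obtain ⟨w⟩ := SimpleGraph.ConnectedComponent.exact (hx.trans hy.symm)
    exact hwalk _ _ w hxA
  rw [← Subtype.val_injective.encard_image]
  refine (Set.encard_le_encard hsupp).trans ?_
  rw [Set.encard_coe_eq_coe_finsetCard]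
  exact_mod_cast hA

section Lattice

variable {G : SimpleGraph (ℤ × ℤ)} {A κ : Type*} [AddCommGroup A] {φ : ℤ × ℤ →+ A}
  {t : κ → Finset (ℤ × ℤ)} {k : ℕ}

open Classical in
/-- The periodic image whose white pixels are the translates of the tiles `t a` by the lattice
`φ.ker`. -/
def latticeImage (φ : ℤ × ℤ →+ A) (t : κ → Finset (ℤ × ℤ)) : Image := fun z =>
  if ∃ a, ∃ c ∈ t a, φ z = φ c then Color.white else Color.black

theorem mem_whitePixels_latticeImage {z : ℤ × ℤ} :
    z ∈ whitePixels (latticeImage φ t) ↔ ∃ a, ∃ c ∈ t a, φ z = φ c := by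
  simp only [whitePixels, latticeImage, Set.mem_ofPred_eq]
  split_ifs with h
  · simpa only [true_iff] using h
  · simpa only [reduceCtorEq, false_iff] using h

/-- The translates of the tiles `t a` by the lattice `φ.ker` are pairwise disjoint and pairwise
not `G`-adjacent. -/
def IsSeparated (G : SimpleGraph (ℤ × ℤ)) (φ : ℤ × ℤ →+ A) (t : κ → Finset (ℤ × ℤ)) : Prop :=
  ∀ ⦃a b p q z⦄, p ∈ t a → q ∈ t b → p = z ∨ G.Adj p z → φ z = φ q → a = b ∧ z = q

theorem IsSeparated.sum_card_div_card_le_density [Fintype κ] [Fintype A]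
    (ht : IsSeparated G φ t) (hφ : Function.Surjective φ) :
    ((∑ a, #(t a) : ℕ) : ℝ) / Fintype.card A ≤ density (latticeImage φ t) := by
  classical
  refine div_card_le_density (Function.surjInv hφ) fun z => ?_
  rw [← card_sigma, ← Set.ncard_coe_finset]
  refine Set.ncard_le_ncard_of_injOn (fun s => φ s.2 - φ z) ?_ ?_
  · rintro ⟨a, c⟩ hc
    refine mem_whitePixels_latticeImage.2 ⟨a, c, (mem_sigma.1 hc).2, ?_⟩
    rw [map_add, Function.surjInv_eq hφ, add_sub_cancel]
  · rintro ⟨a, c⟩ hc ⟨b, d⟩ hd h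
    obtain ⟨rfl, rfl⟩ := ht (mem_sigma.1 hc).2 (mem_sigma.1 hd).2 (.inl rfl) (sub_left_injective h)
    rfl

theorem IsSeparated.whiteComponentsLE (ht : IsSeparated G φ t)
    (hG : ∀ ⦃x y⦄ (v : ℤ × ℤ), G.Adj x y → G.Adj (x - v) (y - v)) (hk : ∀ a, #(t a) ≤ k) :
    WhiteComponentsLE G k (latticeImage φ t) := by
  refine whiteComponentsLE_of_closed fun x hx => ?_
  obtain ⟨a, c, hc, hxc⟩ := mem_whitePixels_latticeImage.1 hx
  refine ⟨(t a).image (· + (x - c)), mem_image.2 ⟨c, hc, by simp⟩, card_image_le.trans (hk a), ?_⟩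
  intro y hy z hz hyz
  obtain ⟨p, hp, rfl⟩ := mem_image.1 hy
  obtain ⟨b, q, hq, hzq⟩ := mem_whitePixels_latticeImage.1 hz
  have hadj : G.Adj p (z - (x - c)) := by simpa using hG (x - c) hyz
  obtain ⟨rfl, hzc⟩ := ht hp hq (.inr hadj) (by simp [hxc, hzq])
  exact mem_image.2 ⟨z - (x - c), hzc ▸ hq, by simp⟩

theorem IsSeparated.le_Phi [Fintype κ] [Fintype A] (ht : IsSeparated G φ t)
    (hG : ∀ ⦃x y⦄ (v : ℤ × ℤ), G.Adj x y → G.Adj (x - v) (y - v)) (hφ : Function.Surjective φ)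
    (hk : ∀ a, #(t a) ≤ k) : ((∑ a, #(t a) : ℕ) : ℝ) / Fintype.card A ≤ Phi G k :=
  (ht.sum_card_div_card_le_density hφ).trans (density_le_Phi (ht.whiteComponentsLE hG hk))

end Lattice

theorem grid4_adj_sub ⦃x y : ℤ × ℤ⦄ (v : ℤ × ℤ) (h : grid4.Adj x y) :
    grid4.Adj (x - v) (y - v) := by
  simpa [grid4_adj_iff] using h

theorem grid8_adj_sub ⦃x y : ℤ × ℤ⦄ (v : ℤ × ℤ) (h : grid8.Adj x y) :
    grid8.Adj (x - v) (y - v) := by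
  simpa [grid8_adj_iff] using h

/-- The homomorphism `z ↦ u * z.1 + v * z.2` to `ZMod M`; its kernel is the lattice of periods. -/
def linearMod (M : ℕ) (u v : ℤ) : ℤ × ℤ →+ ZMod M :=
  (Int.castAddHom (ZMod M)).comp
    ((AddMonoidHom.mulLeft u).comp (AddMonoidHom.fst ℤ ℤ) +
      (AddMonoidHom.mulLeft v).comp (AddMonoidHom.snd ℤ ℤ))

section LinearMod

variable {M : ℕ} {u v : ℤ}

theorem linearMod_apply (z : ℤ × ℤ) : linearMod M u v z = ((u * z.1 + v * z.2 : ℤ) : ZMod M) := rfl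

theorem linearMod_eq_iff {x y : ℤ × ℤ} :
    linearMod M u v x = linearMod M u v y ↔ (M : ℤ) ∣ u * (x.1 - y.1) + v * (x.2 - y.2) := by
  rw [eq_comm, linearMod_apply, linearMod_apply, ZMod.intCast_eq_intCast_iff_dvd_sub]
  ring_nf

theorem linearMod_surjective (h : IsCoprime u v) : Function.Surjective (linearMod M u v) := by
  obtain ⟨x, y, hxy⟩ := h
  intro r
  obtain ⟨n, rfl⟩ := ZMod.intCast_surjective r
  refine ⟨(n * x, n * y), ?_⟩
  rw [linearMod_apply]
  congr 1
  linear_combination n * hxy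

end LinearMod

/-! ### Partial rectangles -/

section PartialRect

variable {a b c k : ℕ}

/-- A rectangle with sides `a` and `b`, together with `c` pixels of the next row. -/
def partialRect (a b c : ℕ) : Finset (ℤ × ℤ) :=
  Ico (0 : ℤ) a ×ˢ Ico (0 : ℤ) b ∪ Ico (0 : ℤ) c ×ˢ {(b : ℤ)}

theorem mem_partialRect {z : ℤ × ℤ} : z ∈ partialRect a b c ↔
    ((0 ≤ z.1 ∧ z.1 < a) ∧ (0 ≤ z.2 ∧ z.2 < b)) ∨ ((0 ≤ z.1 ∧ z.1 < c) ∧ z.2 = b) := by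
  simp only [partialRect, mem_union, mem_product, mem_Ico, mem_singleton]

theorem card_partialRect (a b c : ℕ) : #(partialRect a b c) = a * b + c := by
  rw [partialRect, card_union_of_disjoint]
  · simp
  · rw [disjoint_left]
    intro z h h'
    simp only [mem_product, mem_Ico, mem_singleton] at h h'
    lia

theorem eq_of_linearMod_eq_of_mem_partialRect (hca : c ≤ a) {p q z : ℤ × ℤ}
    (hp : p ∈ partialRect a b c) (hq : q ∈ partialRect a b c) (hfst : |p.1 - z.1| ≤ 1)
    (hsnd : |p.2 - z.2| ≤ 1)
    (h : linearMod ((a + 1) * (b + 1) + c + 1) 1 (a + 1) z =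
      linearMod ((a + 1) * (b + 1) + c + 1) 1 (a + 1) q) : z = q := by
  rw [mem_partialRect] at hp hq
  rw [abs_le] at hfst hsnd
  rw [linearMod_eq_iff] at h
  have hX : |z.1 - q.1| < a + 1 := by rw [abs_lt]; lia
  have hY : |z.2 - q.2| ≤ b ∨ (z.2 - q.2 = b + 1 ∧ z.1 - q.1 ≤ c) ∨
      (z.2 - q.2 = -(b + 1) ∧ -c ≤ z.1 - q.1) := by rw [abs_le]; lia
  generalize hXdef : z.1 - q.1 = X at *
  generalize hYdef : z.2 - q.2 = Y at *
  rw [abs_lt] at hX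
  have hlt : |1 * X + (a + 1) * Y| < ((a + 1) * (b + 1) + c + 1 : ℕ) := by
    rw [abs_lt]
    push_cast
    rcases hY with hY | ⟨rfl, hX'⟩ | ⟨rfl, hX'⟩
    · rw [abs_le] at hY
      constructor <;> nlinarith
    · constructor <;> nlinarith
    · constructor <;> nlinarith
  have hzero := Int.eq_zero_of_abs_lt_dvd h hlt
  have hX0 : X = 0 := Int.eq_zero_of_abs_lt_dvd ⟨-Y, by linarith⟩ (abs_lt.2 hX)
  have hY0 : Y = 0 := by
    rw [hX0, mul_zero, zero_add] at hzero
    exact (mul_eq_zero.1 hzero).resolve_left (by positivity)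
  ext <;> lia

theorem le_Phi8_of_partialRect (hca : c ≤ a) (hk : a * b + c ≤ k) :
    ((a * b + c : ℕ) : ℝ) / ((a + 1) * (b + 1) + c + 1 : ℕ) ≤ Phi8 k := by
  have hsep : IsSeparated grid8 (linearMod ((a + 1) * (b + 1) + c + 1) 1 (a + 1))
      fun _ : Unit => partialRect a b c := by
    intro _ _ p q z hp hq hpz h
    refine ⟨rfl, eq_of_linearMod_eq_of_mem_partialRect hca hp hq ?_ ?_ h⟩
    · rcases hpz with rfl | hpz
      · simp
      · exact abs_fst_sub_le_of_grid8_adj hpz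
    · rcases hpz with rfl | hpz
      · simp
      · exact abs_snd_sub_le_of_grid8_adj hpz
  simpa only [Phi8, univ_unique, sum_singleton, card_partialRect, ZMod.card] using
    hsep.le_Phi grid8_adj_sub (linearMod_surjective isCoprime_one_left)
      fun _ => (card_partialRect a b c).trans_le hk

end PartialRect

section Phi8

variable {j k : ℕ}

theorem lt_ceil_two_mul_sqrt {n : ℕ} (h : n ^ 2 < 4 * j) : (n : ℤ) < ⌈2 * √(j : ℝ)⌉ := by
  rw [Int.lt_ceil, ← div_lt_iff₀' two_pos, Int.cast_natCast, Real.lt_sqrt (by positivity), div_pow,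
    div_lt_iff₀ (by norm_num)]
  exact_mod_cast (by linarith : n ^ 2 < j * 2 ^ 2)

theorem exists_eq_mul_add_add_lt_ceil (hj : 1 ≤ j) :
    ∃ a b c : ℕ, c ≤ a ∧ j = a * b + c ∧ ((a + b : ℕ) : ℤ) < ⌈2 * √(j : ℝ)⌉ := by
  obtain ⟨n, hn⟩ : ∃ n, n = Nat.sqrt (j - 1) := ⟨_, rfl⟩
  have hle : n * n ≤ j - 1 := hn ▸ Nat.sqrt_le (j - 1)
  have hlt : j - 1 < (n + 1) * (n + 1) := hn ▸ Nat.lt_succ_sqrt (j - 1)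
  rcases le_or_gt j (n * n + n) with h | h
  · exact ⟨n, n, j - n * n, by lia, by lia, lt_ceil_two_mul_sqrt (by lia)⟩
  · exact ⟨n + 1, n, j - (n * n + n), by lia, by lia, lt_ceil_two_mul_sqrt (by lia)⟩

theorem Phi8_eq_F8 (hk : 1 ≤ k) : Phi8 k = F8 k hk := by
  refine le_antisymm (Phi_le fun I => density_le_F8 hk) (sup'_le _ _ fun j hj => ?_)
  obtain ⟨hj1, hjk⟩ := mem_Icc.1 hj
  obtain ⟨a, b, c, hca, rfl, hceil⟩ := exists_eq_mul_add_add_lt_ceil hj1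
  refine le_trans ?_ (le_Phi8_of_partialRect hca hjk)
  have hceil' : (a + b + 1 : ℝ) ≤ ⌈2 * √((a * b + c : ℕ) : ℝ)⌉ := by
    exact_mod_cast Int.add_one_le_of_lt hceil
  refine div_le_div_of_nonneg_left (by positivity) (by positivity) ?_
  push_cast at hceil' ⊢
  linarith

end Phi8

/-! ### Notched rotated boxes -/

/-- The rotated box `0 ≤ z.1 + z.2 ≤ 2 * a`, `0 ≤ z.1 - z.2 ≤ 2 * b` without `i` consecutive pixels
at the end of the extreme diagonal `z.1 + z.2 = 0`. -/
def notchedBox (a b i : ℕ) : Finset (ℤ × ℤ) :=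
  rotBox 1 (2 * a) 0 (2 * b) ∪ rotBox 0 0 (2 * i) (2 * b)

/-- Twice the center of the point reflection that interlocks a notched box with its partner. -/
def notchVector (i : ℕ) : ℤ × ℤ := ((i : ℤ) - 1, 1 - (i : ℤ))

/-- The two tiles of the periodic image: a notched box and its point reflection. -/
def notchedTile (a b i : ℕ) : Bool → Finset (ℤ × ℤ)
  | false => notchedBox a b i
  | true => (notchedBox a b i).image (notchVector i - ·)

/-- The pixels `x` and `y` differ by at most one in each diagonal coordinate. -/
def DiagClose (x y : ℤ × ℤ) : Prop :=
  |(x.1 + x.2) - (y.1 + y.2)| ≤ 1 ∧ |(x.1 - x.2) - (y.1 - y.2)| ≤ 1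

theorem DiagClose.refl (x : ℤ × ℤ) : DiagClose x x := by
  simp [DiagClose]

theorem diagClose_of_grid4_adj {x y : ℤ × ℤ} (h : grid4.Adj x y) : DiagClose x y := by
  rw [grid4_adj_iff] at h
  simp only [DiagClose, Int.abs_eq_natAbs] at h ⊢
  lia

theorem DiagClose.sub_left {x y : ℤ × ℤ} (h : DiagClose x y) (v : ℤ × ℤ) :
    DiagClose (v - x) (v - y) := by
  simp only [DiagClose, Int.abs_eq_natAbs, Prod.fst_sub, Prod.snd_sub] at h ⊢
  lia

section NotchedBox

variable {a b i : ℕ} {p q x y z : ℤ × ℤ}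

theorem mem_notchedBox : z ∈ notchedBox a b i ↔
    ((0 ≤ z.1 + z.2 ∧ z.1 + z.2 ≤ 2 * a) ∧ (0 ≤ z.1 - z.2 ∧ z.1 - z.2 ≤ 2 * b)) ∧
      (z.1 + z.2 = 0 → 2 * (i : ℤ) ≤ z.1 - z.2) := by
  simp only [notchedBox, mem_union, mem_rotBox]
  lia

theorem card_notchedBox_add (hi : i ≤ b) :
    #(notchedBox a b i) + i = (a + 1) * (b + 1) + a * b := by
  have hdisj : Disjoint (rotBox 1 (2 * a) 0 (2 * b)) (rotBox 0 0 (2 * i) (2 * b)) := by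
    rw [disjoint_left]
    intro z h h'
    rw [mem_rotBox] at h h'
    lia
  have hbody : 2 * #(rotBox 1 (2 * a) 0 (2 * b)) = 2 * a * (2 * b + 1) := by
    have ha : #(Icc (1 : ℤ) (2 * a)) = 2 * a := by rw [Int.card_Icc]; lia
    have hb : #(Icc (0 : ℤ) (2 * b)) = 2 * b + 1 := by rw [Int.card_Icc]; lia
    rw [two_mul_card_rotBox_of_even (.inl (by simp [ha])), ha, hb]
  have hdiag : 2 * (#(rotBox 0 0 (2 * i) (2 * b)) : ℤ) = 2 * (b + 1 - i) := by
    have hodd : ¬Even #(Icc (2 * i : ℤ) (2 * b)) := by rw [Int.card_Icc]; grind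
    rw [two_mul_card_rotBox, sum_negOnePow_Icc, sum_negOnePow_Icc, if_neg hodd, if_neg (by simp),
      Int.negOnePow_two_mul, Int.card_Icc, Int.card_Icc]
    simp only [Int.negOnePow_zero, Units.val_one]
    lia
  rw [notchedBox, card_union_of_disjoint hdisj]
  lia

theorem exists_half_of_linearMod_eq {N : ℕ}
    (h : linearMod (2 * N) (2 * b + 3) (2 * b + 1) x =
      linearMod (2 * N) (2 * b + 3) (2 * b + 1) y) :
    ∃ U V : ℤ, (x.1 + x.2) - (y.1 + y.2) = 2 * U ∧ (x.1 - x.2) - (y.1 - y.2) = 2 * V ∧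
      (N : ℤ) ∣ 2 * (b + 1) * U + V := by
  obtain ⟨l, hl⟩ := linearMod_eq_iff.1 h
  push_cast at hl
  generalize hX : x.1 - y.1 = X at hl
  generalize hY : x.2 - y.2 = Y at hl
  obtain ⟨V, hV⟩ : ∃ V, X - Y = 2 * V := ⟨N * l - (b + 1) * (X + Y), by linear_combination hl⟩
  refine ⟨V + Y, V, by lia, by lia, l, ?_⟩
  have hX' : X = 2 * V + Y := by lia
  subst hX'
  linarith

theorem eq_of_linearMod_eq_of_mem_notchedBox {N : ℕ} (hi : i ≤ b)
    (hN : N + i = 2 * ((a + 1) * (b + 1)))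
    (hp : p ∈ notchedBox a b i) (hq : q ∈ notchedBox a b i) (hpz : DiagClose p z)
    (h : linearMod (2 * N) (2 * b + 3) (2 * b + 1) z =
      linearMod (2 * N) (2 * b + 3) (2 * b + 1) q) : z = q := by
  obtain ⟨U, V, hU, hV, hdvd⟩ := exists_half_of_linearMod_eq h
  obtain ⟨hp, -⟩ := mem_notchedBox.1 hp
  obtain ⟨hq, -⟩ := mem_notchedBox.1 hq
  obtain ⟨hsum, hdiff⟩ := hpz
  rw [abs_le] at hsum hdiff
  have hUa : -(a : ℤ) ≤ U ∧ U ≤ a := by lia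
  have hVb : -(b : ℤ) ≤ V ∧ V ≤ b := by lia
  zify at hi hN
  have hzero : 2 * (b + 1) * U + V = 0 := by
    refine Int.eq_zero_of_abs_lt_dvd hdvd (abs_lt.2 ⟨?_, ?_⟩) <;> nlinarith
  have hV0 : V = 0 := by
    refine Int.eq_zero_of_abs_lt_dvd (m := 2 * (b + 1)) ⟨-U, by linarith⟩ ?_
    rw [abs_lt]
    lia
  have hU0 : U = 0 := by
    rw [hV0, add_zero] at hzero
    exact (mul_eq_zero.1 hzero).resolve_left (by positivity)
  ext <;> lia

theorem linearMod_ne_of_mem_notchedBox {N : ℕ} (hi : i ≤ b)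
    (hN : N + i = 2 * ((a + 1) * (b + 1)))
    (hp : p ∈ notchedBox a b i) (hq : notchVector i - q ∈ notchedBox a b i)
    (hpz : DiagClose p z) :
    linearMod (2 * N) (2 * b + 3) (2 * b + 1) z ≠
      linearMod (2 * N) (2 * b + 3) (2 * b + 1) q := by
  intro h
  obtain ⟨U, V, hU, hV, l, hl⟩ := exists_half_of_linearMod_eq h
  obtain ⟨hp, hp0⟩ := mem_notchedBox.1 hp
  obtain ⟨hq, hq0⟩ := mem_notchedBox.1 hq
  simp only [notchVector, Prod.fst_sub, Prod.snd_sub] at hq hq0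
  obtain ⟨hsum, hdiff⟩ := hpz
  rw [abs_le] at hsum hdiff
  have hUa : 0 ≤ U ∧ U ≤ 2 * a := by lia
  have hVb : 1 ≤ V + i ∧ V + i < 2 * (b + 1) := by lia
  zify at hi hN
  have hUb := mul_nonneg (show (0 : ℤ) ≤ 2 * (b + 1) by positivity) hUa.1
  have hl0 : 0 ≤ l := by nlinarith
  have hl1 : l ≤ 1 := by nlinarith
  obtain rfl | rfl : l = 0 ∨ l = 1 := by lia
  · have hU0 : U = 0 := by nlinarith
    rw [hU0] at hl
    lia
  · have hVi : V + i = 0 := by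
      refine Int.eq_zero_of_abs_lt_dvd (m := 2 * (b + 1)) ⟨a + 1 - U, by linarith⟩ ?_
      rw [abs_lt]
      lia
    lia

theorem mem_notchedTile_true :
    z ∈ notchedTile a b i true ↔ notchVector i - z ∈ notchedBox a b i := by
  rw [notchedTile, mem_image]
  constructor
  · rintro ⟨y, hy, rfl⟩
    rwa [sub_sub_cancel]
  · exact fun h => ⟨_, h, sub_sub_cancel _ _⟩

theorem card_notchedTile (s : Bool) : #(notchedTile a b i s) = #(notchedBox a b i) := by
  cases s
  · rfl
  · exact card_image_of_injective _ sub_right_injective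

theorem isSeparated_notchedTile {N : ℕ} (hi : i ≤ b) (hN : N + i = 2 * ((a + 1) * (b + 1))) :
    IsSeparated grid4 (linearMod (2 * N) (2 * b + 3) (2 * b + 1)) (notchedTile a b i) := by
  intro s s' p q z hp hq hpz h
  replace hpz : DiagClose p z := hpz.elim (fun h => h ▸ .refl p) diagClose_of_grid4_adj
  have h' : linearMod (2 * N) (2 * b + 3) (2 * b + 1) (notchVector i - z) =
      linearMod (2 * N) (2 * b + 3) (2 * b + 1) (notchVector i - q) := by
    rw [map_sub, map_sub, h]
  match s, s' with
  | false, false => exact ⟨rfl, eq_of_linearMod_eq_of_mem_notchedBox hi hN hp hq hpz h⟩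
  | false, true =>
    exact absurd h (linearMod_ne_of_mem_notchedBox hi hN hp (mem_notchedTile_true.1 hq) hpz)
  | true, false =>
    refine absurd h' (linearMod_ne_of_mem_notchedBox hi hN (mem_notchedTile_true.1 hp) ?_
      (hpz.sub_left _))
    rwa [sub_sub_cancel]
  | true, true =>
    exact ⟨rfl, sub_right_injective (eq_of_linearMod_eq_of_mem_notchedBox hi hN
      (mem_notchedTile_true.1 hp) (mem_notchedTile_true.1 hq) (hpz.sub_left _) h')⟩

theorem le_Phi4_of_notchedBox {j k : ℕ} (hi : i ≤ b) (hj : j + i = (a + 1) * (b + 1) + a * b)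
    (hjk : j ≤ k) : (j : ℝ) / (j + (a + b + 1)) ≤ Phi4 k := by
  have hcard : ∀ s, #(notchedTile a b i s) = j := fun s => by
    have := card_notchedBox_add (a := a) hi
    rw [card_notchedTile]
    lia
  have hsep : IsSeparated grid4 (linearMod (2 * (j + a + b + 1)) (2 * b + 3) (2 * b + 1))
      (notchedTile a b i) := isSeparated_notchedTile hi (by lia)
  have hcoprime : IsCoprime (2 * b + 3 : ℤ) (2 * b + 1) := ⟨-b, b + 1, by ring⟩
  have hle := hsep.le_Phi grid4_adj_sub (linearMod_surjective hcoprime)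
    fun s => (hcard s).trans_le hjk
  simp only [hcard, sum_const, card_univ, Fintype.card_bool, ZMod.card, smul_eq_mul] at hle
  push_cast at hle
  rw [mul_div_mul_left _ _ two_ne_zero] at hle
  simpa only [Phi4, add_assoc] using hle

end NotchedBox

/-! ### Sizes for which the bound for 4-adjacency is attained -/

section CeilSqrt

variable {j : ℕ}

theorem ceil_two_mul_sqrt_le {n : ℕ} (h : 8 * j ≤ n ^ 2 + 4) :
    ⌈2 * √(2 * (j : ℝ) - 1)⌉ ≤ (n : ℤ) := by
  have hsq : 8 * (j : ℝ) ≤ n ^ 2 + 4 := by exact_mod_cast h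
  rw [Int.ceil_le, ← le_div_iff₀' two_pos, Int.cast_natCast]
  exact Real.sqrt_le_iff.2 ⟨by positivity, by linarith⟩

theorem eight_mul_le_ceil_sq_add (hj : 1 ≤ j) :
    8 * (j : ℤ) ≤ ⌈2 * √(2 * (j : ℝ) - 1)⌉ ^ 2 + 4 := by
  have hj' : (1 : ℝ) ≤ j := by exact_mod_cast hj
  have hsq := Real.sq_sqrt (show (0 : ℝ) ≤ 2 * j - 1 by linarith)
  have hceil := pow_le_pow_left₀ (by positivity) (Int.le_ceil (2 * √(2 * (j : ℝ) - 1))) 2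
  have h : 8 * (j : ℝ) ≤ (⌈2 * √(2 * (j : ℝ) - 1)⌉ : ℝ) ^ 2 + 4 := by linarith
  exact_mod_cast h

theorem two_le_ceil_two_mul_sqrt (hj : 1 ≤ j) : 2 ≤ ⌈2 * √(2 * (j : ℝ) - 1)⌉ := by
  have hj' : (1 : ℝ) ≤ j := by exact_mod_cast hj
  have hsqrt : 1 ≤ √(2 * (j : ℝ) - 1) := Real.one_le_sqrt.2 (by linarith)
  have hceil : (2 : ℝ) ≤ ⌈2 * √(2 * (j : ℝ) - 1)⌉ :=
    le_trans (by linarith) (Int.le_ceil _)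
  exact_mod_cast hceil

end CeilSqrt

theorem F4_le_div {k j₀ m : ℕ} (hk : 1 ≤ k) (hj₀ : 1 ≤ j₀)
    (h : ∀ j t : ℤ, j ≤ k → 2 ≤ t → 8 * j ≤ t ^ 2 + 4 → j * (2 * m) ≤ j₀ * t) :
    F4 k hk ≤ (j₀ : ℝ) / (j₀ + m) := by
  refine sup'_le _ _ fun j hj => ?_
  obtain ⟨hj1, hjk⟩ := mem_Icc.1 hj
  have hmul : (j : ℝ) * (2 * m) ≤ j₀ * (⌈2 * √(2 * (j : ℝ) - 1)⌉ : ℝ) := by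
    exact_mod_cast h j _ (by exact_mod_cast hjk) (two_le_ceil_two_mul_sqrt hj1)
      (eight_mul_le_ceil_sq_add hj1)
  have := ceil_two_mul_sqrt_nonneg (2 * (j : ℝ) - 1)
  have : (0 : ℝ) < j := by exact_mod_cast hj1
  have : (0 : ℝ) < j₀ := by exact_mod_cast hj₀
  rw [div_le_div_iff₀ (by positivity) (by positivity)]
  linarith

section Arithmetic

variable {m s k j j₀ t : ℤ}

theorem mul_two_mul_le_of_two_mul_lt (hm : 1 ≤ m) (hs : m ^ 2 ≤ 2 * s) (hk0 : 0 ≤ k)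
    (hk : 4 * k ≤ 4 * s + m) (ht : 2 * m < t) : k * (2 * m) ≤ min k s * t := by
  rcases min_choice k s with h | h <;> rw [h]
  · exact mul_le_mul_of_nonneg_left ht.le hk0
  · have hs0 : 0 ≤ s := by nlinarith
    calc k * (2 * m) ≤ s * (2 * m + 1) := by nlinarith
      _ ≤ s * t := mul_le_mul_of_nonneg_left ht hs0

theorem mul_two_mul_le_of_lt_two_mul (hj₀ : 2 * m ^ 2 ≤ 4 * j₀ + m) (ht2 : 2 ≤ t)
    (ht : t < 2 * m) (hjt : 8 * j ≤ t ^ 2 + 4) : j * (2 * m) ≤ j₀ * t := by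
  rcases (show t = 2 * m - 1 ∨ (m = 2 ∧ t = 2) ∨ (3 ≤ m ∧ t ≤ 2 * m - 2) by lia) with
    rfl | ⟨rfl, rfl⟩ | ⟨hm, ht⟩
  · obtain ⟨r, hr⟩ := Int.even_mul_pred_self m
    have hjr : j ≤ r := by lia
    nlinarith
  · lia
  · have hsq : t ^ 2 + 4 ≤ (2 * m - 1) * t := by nlinarith
    nlinarith

theorem mul_two_mul_le_min_mul (hm : 1 ≤ m) (hs : m ^ 2 ≤ 2 * s)
    (hk : 2 * m ^ 2 ≤ 4 * k + m) (hk' : 4 * k ≤ 4 * s + m) (hjk : j ≤ k) (ht : 2 ≤ t)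
    (hjt : 8 * j ≤ t ^ 2 + 4) : j * (2 * m) ≤ min k s * t := by
  rcases lt_trichotomy t (2 * m) with hlt | rfl | hgt
  · exact mul_two_mul_le_of_lt_two_mul (by lia) ht hlt hjt
  · exact mul_le_mul_of_nonneg_right (by lia) (by lia)
  · have hk0 : 0 ≤ k := by nlinarith
    exact (mul_le_mul_of_nonneg_right hjk (by lia)).trans
      (mul_two_mul_le_of_two_mul_lt hm hs hk0 hk' hgt)

end Arithmetic

/-- The integers of the `m`-th interval in the union `setS`. The intervals around `s0 n` and `s2 n`
have indices `2 * n - 1` and `2 * n`: both center values are `m ^ 2 / 2` rounded up. -/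
def setSBlock (m : ℕ) : Finset ℕ :=
  Icc ((2 * m ^ 2 + 3 - m) / 4) ((2 * m ^ 2 + m + 1) / 4)

section SetSBlock

variable {m n k : ℕ}

theorem mem_setSBlock : k ∈ setSBlock m ↔ 2 * m ^ 2 ≤ 4 * k + m ∧ 4 * k ≤ 2 * m ^ 2 + m + 1 := by
  have hm : m ≤ m ^ 2 := Nat.le_self_pow two_ne_zero m
  rw [setSBlock, mem_Icc]
  lia

theorem mem_Icc_s0_iff : (k : ℝ) ∈ Set.Icc (s0 (n + 1) - ((n + 1 : ℕ) : ℝ) / 2)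
    (s0 (n + 1) + (((n + 1 : ℕ) : ℝ) - 1) / 2) ↔ k ∈ setSBlock (2 * n + 1) := by
  have hlower : s0 (n + 1) - ((n + 1 : ℕ) : ℝ) / 2 ≤ k ↔ 8 * n ^ 2 + 6 * n + 2 ≤ 4 * k := by
    rw [← Nat.cast_le (α := ℝ), s0]
    push_cast
    constructor <;> intro h <;> linarith
  have hupper : (k : ℝ) ≤ s0 (n + 1) + (((n + 1 : ℕ) : ℝ) - 1) / 2 ↔
      4 * k ≤ 8 * n ^ 2 + 10 * n + 4 := by
    rw [← Nat.cast_le (α := ℝ), s0]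
    push_cast
    constructor <;> intro h <;> linarith
  rw [Set.mem_Icc, hlower, hupper, mem_setSBlock]
  lia

theorem mem_Icc_s2_iff : (k : ℝ) ∈ Set.Icc (s2 n - (n : ℝ) / 2) (s2 n + (n : ℝ) / 2) ↔
    k ∈ setSBlock (2 * n) := by
  have hlower : s2 n - (n : ℝ) / 2 ≤ k ↔ 8 * n ^ 2 ≤ 4 * k + 2 * n := by
    rw [← Nat.cast_le (α := ℝ), s2]
    push_cast
    constructor <;> intro h <;> linarith
  have hupper : (k : ℝ) ≤ s2 n + (n : ℝ) / 2 ↔ 4 * k ≤ 8 * n ^ 2 + 2 * n := by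
    rw [← Nat.cast_le (α := ℝ), s2]
    push_cast
    constructor <;> intro h <;> linarith
  rw [Set.mem_Icc, hlower, hupper, mem_setSBlock]
  lia

theorem mem_setS_iff : k ∈ setS ↔ ∃ m, 1 ≤ m ∧ k ∈ setSBlock m := by
  constructor
  · rintro ⟨-, n, hn, h | h⟩
    · obtain ⟨n, rfl⟩ := Nat.exists_eq_add_of_le' hn
      exact ⟨2 * n + 1, by lia, mem_Icc_s0_iff.1 h⟩
    · exact ⟨2 * n, by lia, mem_Icc_s2_iff.1 h⟩
  · rintro ⟨m, hm, h⟩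
    have hk : 1 ≤ k := by
      rw [mem_setSBlock] at h
      nlinarith
    obtain ⟨n, rfl | rfl⟩ := m.even_or_odd'
    · exact ⟨hk, n, by lia, .inr (mem_Icc_s2_iff.2 h)⟩
    · exact ⟨hk, n + 1, by lia, .inl (mem_Icc_s0_iff.2 h)⟩

theorem Phi4_eq_F4_of_mem_setSBlock (hm : 1 ≤ m) (hk : 1 ≤ k) (h : k ∈ setSBlock m) :
    Phi4 k = F4 k hk := by
  refine le_antisymm (Phi_le fun I => density_le_F4 hk) ?_
  obtain ⟨a, b, rfl, hab⟩ : ∃ a b, m = a + b + 1 ∧ (b = a ∨ b = a + 1) :=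
    ⟨(m - 1) / 2, m / 2, by lia, by lia⟩
  obtain ⟨s, hs⟩ : ∃ s, s = (a + 1) * (b + 1) + a * b := ⟨_, rfl⟩
  obtain ⟨hlower, hupper⟩ := mem_setSBlock.1 h
  have hss : (a + b + 1) ^ 2 ≤ 2 * s := by
    rcases hab with rfl | rfl <;> lia
  have hks : 4 * k ≤ 4 * s + (a + b + 1) := by
    rcases hab with rfl | rfl <;> lia
  have hnotch : s - min k s ≤ b := by
    rcases hab with rfl | rfl <;> lia
  have hs1 : 1 ≤ s := by nlinarith
  have hF := F4_le_div (j₀ := min k s) (m := a + b + 1) hk (le_min hk hs1) fun j t hjk ht hjt => by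
    push_cast
    exact mul_two_mul_le_min_mul (by lia) (by exact_mod_cast hss)
      (by exact_mod_cast hlower) (by exact_mod_cast hks) hjk ht hjt
  refine hF.trans ?_
  have hle := le_Phi4_of_notchedBox (a := a) hnotch (j := min k s) (by lia) (min_le_left k s)
  exact_mod_cast hle

theorem Phi4_eq_F4_of_mem_setS (hk : 1 ≤ k) (h : k ∈ setS) : Phi4 k = F4 k hk := by
  obtain ⟨m, hm, hkm⟩ := mem_setS_iff.1 h
  exact Phi4_eq_F4_of_mem_setSBlock hm hk hkm

end SetSBlock

/-! ### Sizes for which the bound for 4-adjacency is not attained -/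

section SetU

variable {m s k : ℕ}

theorem exists_of_mem_setU (h : k ∈ setU) :
    ∃ m s, 2 ≤ m ∧ 2 * s = m * (m + 1) ∧ s ≤ k ∧ 4 * k ≤ 4 * s + m := by
  obtain ⟨hk, n, hn, ⟨hlower, hupper⟩ | ⟨hlower, hupper⟩⟩ := h
  · obtain ⟨r, rfl⟩ := Nat.exists_eq_add_of_le' hn
    rw [s1] at hlower hupper
    push_cast at hlower hupper
    have hle : 2 * r ^ 2 + 3 * r + 1 ≤ k := by
      rw [← Nat.cast_le (α := ℝ)]
      push_cast
      linarith
    have hge : 2 * k ≤ 2 * (2 * r ^ 2 + 3 * r + 1) + r := by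
      rw [← Nat.cast_le (α := ℝ)]
      push_cast
      linarith
    refine ⟨2 * r + 1, 2 * r ^ 2 + 3 * r + 1, ?_, by ring, hle, by lia⟩
    rcases r.eq_zero_or_pos with rfl | hr <;> lia
  · rw [s3] at hlower hupper
    have hle : n * (2 * n + 1) ≤ k := by exact_mod_cast hlower
    have hge : 2 * k ≤ 2 * (n * (2 * n + 1)) + n := by
      rw [← Nat.cast_le (α := ℝ)]
      push_cast
      linarith
    exact ⟨2 * n, n * (2 * n + 1), by lia, by ring, hle, by lia⟩

theorem div_le_F4 (hs1 : 1 ≤ s) (hs : 2 * s = m * (m + 1)) (hsk : s ≤ k) :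
    2 * (s : ℝ) / (2 * s + (2 * m + 1)) ≤ F4 k (hs1.trans hsk) := by
  refine le_trans ?_ (le_F4 hs1 hsk)
  have hceil : (⌈2 * √(2 * (s : ℝ) - 1)⌉ : ℝ) ≤ 2 * m + 1 := by
    exact_mod_cast ceil_two_mul_sqrt_le (n := 2 * m + 1) (by lia)
  have : (0 : ℝ) < s := by exact_mod_cast hs1
  have := ceil_two_mul_sqrt_nonneg (2 * (s : ℝ) - 1)
  rw [div_le_div_iff₀ (by positivity) (by positivity)]
  nlinarith

theorem Phi4_lt_F4_of_mem_setU (hk : 1 ≤ k) (h : k ∈ setU) : Phi4 k < F4 k hk := by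
  obtain ⟨m, s, hm, hs, hsk, hks⟩ := exists_of_mem_setU h
  have hs1 : 1 ≤ s := by nlinarith
  have hmul : k * (2 * m + 1) < s * (2 * m + 1 + 1) := by nlinarith
  obtain ⟨e, o, he, heven, ho, heo, heos, hsum⟩ : ∃ e o, 2 ≤ e ∧ Even e ∧ 3 ≤ o ∧
      (o = e + 1 ∨ e = o + 1) ∧ 2 * s = e * o ∧ e + o = 2 * m + 1 := by
    rcases m.even_or_odd with hm' | hm'
    · exact ⟨m, m + 1, hm, hm', by lia, by lia, hs, by lia⟩
    · exact ⟨m + 1, m, by lia, hm'.add_one, by grind, by lia, by lia, by lia⟩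
  obtain ⟨θ, hθ, hdensity⟩ :=
    exists_lt_forall_density_le he heven ho heo heos (by rwa [hsum]) hk
  have hsum' : (e + o : ℝ) = 2 * m + 1 := by exact_mod_cast hsum
  rw [hsum'] at hθ
  exact (Phi_le hdensity).trans_lt (hθ.trans_le (div_le_F4 hs1 hs hsk))

end SetU

/-! ### The natural density of `setS` -/

section NaturalDensity

variable {i m N : ℕ}

theorem lt_of_mem_setSBlock {x y : ℕ} (him : i < m) (hx : x ∈ setSBlock i) (hy : y ∈ setSBlock m) :
    x < y := by
  rw [mem_setSBlock] at hx hy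
  by_contra! hyx
  have hi : i = 0 := by nlinarith
  subst hi
  have hx0 : x = 0 := by lia
  nlinarith

theorem card_setSBlock (m : ℕ) :
    2 * m ≤ 4 * #(setSBlock m) + 1 ∧ 4 * #(setSBlock m) ≤ 2 * m + 5 := by
  have hm : m ≤ m ^ 2 := Nat.le_self_pow two_ne_zero m
  rw [setSBlock, Nat.card_Icc]
  lia

theorem exists_period (N : ℕ) : ∃ m, 2 * m ^ 2 ≤ 4 * N + m ∧ 4 * N < 2 * m ^ 2 + 3 * m + 1 := by
  induction N with
  | zero => exact ⟨0, by simp⟩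
  | succ N ih =>
    obtain ⟨m, hle, hlt⟩ := ih
    rcases lt_or_ge (4 * (N + 1)) (2 * m ^ 2 + 3 * m + 1) with h | h
    · exact ⟨m, by lia, h⟩
    · exact ⟨m + 1, by lia, by lia⟩

theorem setS_inter_Icc_subset (hN : 4 * N < 2 * m ^ 2 + 3 * m + 1) :
    setS ∩ Set.Icc 1 N ⊆ ((range (m + 1)).biUnion setSBlock : Finset ℕ) := by
  rintro k ⟨hk, -, hkN⟩
  obtain ⟨i, -, hki⟩ := mem_setS_iff.1 hk
  rw [mem_coe, mem_biUnion]
  refine ⟨i, mem_range.2 ?_, hki⟩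
  rw [mem_setSBlock] at hki
  by_contra! hmi
  nlinarith

theorem subset_setS_inter_Icc (hN : 2 * m ^ 2 ≤ 4 * N + m) :
    (((Ico 1 m).biUnion setSBlock : Finset ℕ) : Set ℕ) ⊆ setS ∩ Set.Icc 1 N := by
  intro k hk
  obtain ⟨i, hi, hki⟩ := mem_biUnion.1 (mem_coe.1 hk)
  obtain ⟨hi1, him⟩ := mem_Ico.1 hi
  have hkS : k ∈ setS := mem_setS_iff.2 ⟨i, hi1, hki⟩
  refine ⟨hkS, hkS.1, ?_⟩
  rw [mem_setSBlock] at hki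
  by_contra! hNk
  nlinarith

theorem sum_range_two_mul_add (n c : ℕ) :
    ∑ i ∈ range n, (2 * i + (c + 1)) = n ^ 2 + c * n := by
  induction n with
  | zero => simp
  | succ n ih =>
    rw [sum_range_succ, ih]
    ring

theorem four_mul_ncard_setS_le (hN : 4 * N < 2 * m ^ 2 + 3 * m + 1) :
    4 * (setS ∩ Set.Icc 1 N).ncard ≤ (m + 1) ^ 2 + 4 * (m + 1) := by
  have hle := Set.ncard_le_ncard (setS_inter_Icc_subset hN) (finite_toSet _)
  rw [Set.ncard_coe_finset] at hle
  calc 4 * (setS ∩ Set.Icc 1 N).ncard ≤ 4 * ∑ i ∈ range (m + 1), #(setSBlock i) :=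
        Nat.mul_le_mul_left 4 (hle.trans card_biUnion_le)
    _ ≤ ∑ i ∈ range (m + 1), (2 * i + 5) := by
        rw [mul_sum]
        exact sum_le_sum fun i _ => (card_setSBlock i).2
    _ = (m + 1) ^ 2 + 4 * (m + 1) := sum_range_two_mul_add (m + 1) 4

theorem pairwiseDisjoint_setSBlock (s : Set ℕ) : s.PairwiseDisjoint setSBlock := by
  intro i _ m _ him
  refine disjoint_left.2 fun x hi hm => ?_
  rcases him.lt_or_gt with h | h
  · exact (lt_of_mem_setSBlock h hi hm).false
  · exact (lt_of_mem_setSBlock h hm hi).false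

theorem le_four_mul_ncard_setS (hN : 2 * (m + 1) ^ 2 ≤ 4 * N + (m + 1)) :
    m ^ 2 ≤ 4 * (setS ∩ Set.Icc 1 N).ncard := by
  have hle := Set.ncard_le_ncard (subset_setS_inter_Icc hN) ((Set.finite_Icc 1 N).inter_of_right _)
  rw [Set.ncard_coe_finset, card_biUnion (pairwiseDisjoint_setSBlock _),
    sum_Ico_eq_sum_range] at hle
  calc m ^ 2 = ∑ i ∈ range m, (2 * i + (0 + 1)) := by
        rw [sum_range_two_mul_add m 0, zero_mul, add_zero]
    _ ≤ 4 * ∑ i ∈ range m, #(setSBlock (1 + i)) := by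
        rw [mul_sum]
        refine sum_le_sum fun i _ => ?_
        have := (card_setSBlock (1 + i)).1
        lia
    _ ≤ 4 * (setS ∩ Set.Icc 1 N).ncard := Nat.mul_le_mul_left 4 hle

theorem abs_ncard_setS_div_sub_le (hN : 1 ≤ N) :
    |((setS ∩ Set.Icc 1 N).ncard : ℝ) / N - 1 / 2| ≤ 5 / √N := by
  obtain ⟨m, hm, hm'⟩ := exists_period N
  obtain ⟨m, rfl⟩ : ∃ n, m = n + 1 := Nat.exists_eq_add_one.2 (by
    by_contra! h
    obtain rfl : m = 0 := by lia
    lia)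
  have hupper := four_mul_ncard_setS_le hm'
  have hlower := le_four_mul_ncard_setS hm
  generalize (setS ∩ Set.Icc 1 N).ncard = C at hupper hlower ⊢
  have hN1 : (1 : ℝ) ≤ N := by exact_mod_cast hN
  have hsqrt1 : 1 ≤ √(N : ℝ) := Real.one_le_sqrt.2 hN1
  have hsq : √(N : ℝ) * √N = N := Real.mul_self_sqrt (by positivity)
  have hmN : (m + 1 : ℝ) ≤ 2 * √N := by
    refine abs_le_of_sq_le_sq' ?_ (by positivity) |>.2
    have : (m + 1) ^ 2 ≤ 4 * N := by nlinarith
    have : (m + 1 : ℝ) ^ 2 ≤ 4 * N := by exact_mod_cast this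
    nlinarith
  have hdiff : |(C : ℝ) - N / 2| ≤ 5 * √N := by
    rify at hm hm' hupper hlower
    rw [abs_le]
    constructor <;> nlinarith
  calc |(C : ℝ) / N - 1 / 2| = |(C : ℝ) - N / 2| / N := by
        have hN0 : (N : ℝ) ≠ 0 := by positivity
        rw [← Nat.abs_cast N, ← abs_div, Nat.abs_cast, sub_div, div_right_comm, div_self hN0]
    _ ≤ 5 * √N / N := by gcongr
    _ = 5 / √N := by
        rw [mul_div_assoc, Real.sqrt_div_self', mul_one_div]

theorem hasNaturalDensity_setS : HasNaturalDensity setS (1 / 2) := by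
  have hlim : Tendsto (fun N : ℕ => 5 / √(N : ℝ)) atTop (𝓝 0) :=
    tendsto_const_nhds.div_atTop (Real.tendsto_sqrt_atTop.comp tendsto_natCast_atTop_atTop)
  refine tendsto_iff_norm_sub_tendsto_zero.2
    (squeeze_zero' (.of_forall fun _ => norm_nonneg _) ?_ hlim)
  filter_upwards [eventually_ge_atTop 1] with N hN
  exact abs_ncard_setS_div_sub_le hN

end NaturalDensity

end WhiteDensity

end

theorem theorem1p1 :
    (∀ (k : ℕ) (hk : 1 ≤ k), WhiteDensity.Phi8 k = WhiteDensity.F8 k hk) ∧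
    (∀ (k : ℕ) (hk : 1 ≤ k), WhiteDensity.Phi4 k ≤ WhiteDensity.F4 k hk) ∧
    (∀ (k : ℕ) (hk : 1 ≤ k), k ∈ WhiteDensity.setS →
      WhiteDensity.Phi4 k = WhiteDensity.F4 k hk) ∧
    (∀ (k : ℕ) (hk : 1 ≤ k), k ∈ WhiteDensity.setU →
      WhiteDensity.Phi4 k < WhiteDensity.F4 k hk) ∧
    WhiteDensity.HasNaturalDensity WhiteDensity.setS (1 / 2) := by
  exact ⟨fun _ hk => WhiteDensity.Phi8_eq_F8 hk,
    fun _ hk => WhiteDensity.Phi_le fun _ => WhiteDensity.density_le_F4 hk,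
    fun _ hk h => WhiteDensity.Phi4_eq_F4_of_mem_setS hk h,
    fun _ hk h => WhiteDensity.Phi4_lt_F4_of_mem_setU hk h,
    WhiteDensity.hasNaturalDensity_setS⟩
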